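/- **Setting.** Let $n=d+1\ge 1$, let $X\subseteq\mathbb{R}^n=\mathbb{R}\times\mathbb{R}^{d}$ be a nonempty open set with points $x=(t,y)$, let $m\in\mathbb{N}$, and let $G=G(t,y,(z_{p,q}))$ be complex-valued and real-analytic on $X\times\mathbb{C}^N$, the complex variables $z_{p,q}$ being indexed by the $N$ pairs $(p,q)\in\mathbb{N}\times\mathbb{N}^{d}$ with $p<m$, $p+|q|\le m$. Put $$T(x,D)U(x)=D_t^mU(t,y)-G\big(t,y,\dots,D_t^pD_y^qU(t,y),\dots\big).$$ Let $t_0\in\mathbb{R}$, $S=\{(t,y)\in X: t=t_0\}$, and for $0\le p<m$ let $g_p$ be complex-valued and analytic on the open set $\{y:(t_0,y)\in X\}$. Consider the analytic initial value problem $$T(x,D)U=0\ \text{ on } X,\qquad D_t^pU(t_0,y)=g_p(y)\quad(0\le p<m,\ (t_0,y)\in S).$$ **Algebras.** $\mathcal{C}^\infty(X)$ denotes the complex-valued smooth functions on $X$. Let $\mathcal{J}(X)$ be the ideal of $\mathcal{C}^\infty(X)^{\mathbb{N}}$ of all $w=(w_\nu)$ for which there is a set $\Gamma\subseteq X$ of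 first Baire category in $X$ such that for every $x\in X\setminus\Gamma$ there is $\lambda$ with $D^pw_\nu(x)=0$ for all $\nu\ge\lambda$ and all $p\in\mathbb{N}^n$. Let $\mathcal{I}(X)$ be the ideal of all $w$ for which there are a set $\Gamma\subseteq X$ of first Baire category in $X$ and sets $\Gamma_\nu\subseteq X$ closed in $X$, with $\Gamma=\bigcap_\lambda\bigcup_{\nu\ge\lambda}\Gamma_\nu$, such that for every $x\in X\setminus\Gamma$ there is $\lambda$ such that for each $\nu\ge\lambda$ the function $w_\nu$ vanishes on some open set $\Delta_\nu$ with $x\in\Delta_\nu\subseteq X\setminus\Gamma_\nu$. The special multi-foam algebra and the multi-foam algebra are $$A_{\text{Baire I}}(X)=\mathcal{C}^\infty(X)^{\mathbb{N}}/\mathcal{I}(X),\qquad B_{\text{Baire I}}(X)=\mathcal{C}^\infty(X)^{\mathbb{N}}/\mathcal{J}(X).$$ Applied termwise to sequences, $T(x,D)$ induces mappings of each of these algebras into itself, and restriction to an open $Y\subseteq X$ induces homomorphisms $A_{\text{Baire I}}(X)\to A_{\text{Baire I}}(Y)$, $B_{\text{Baire I}}(X)\to B_{\text{Baire I}}(Y)$.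 A function in $\mathcal{C}^\infty(Y)$ is identified with the class of the corresponding constant sequence. **Theorem 1.** There are a set $\Sigma\subset X$, closed and nowhere dense in $X$, of Lebesgue measure zero and disjoint from $S$, an analytic function $\psi:X\setminus\Sigma\to\mathbb{C}$, and a sequence $s=(s_\nu)\in\mathcal{C}^\infty(X)^{\mathbb{N}}$ such that 1. $T(x,D)\psi=0$ on $X\setminus\Sigma$, and $D_t^p\psi(t_0,y)=g_p(y)$ for $0\le p<m$ and all $(t_0,y)\in S$; 2. for every compact $K\subset X\setminus\Sigma$ one has $s_\nu=\psi$ on $K$ for all sufficiently large $\nu$; 3. $U=s+\mathcal{I}(X)\in A_{\text{Baire I}}(X)$ is a global generalized solution: $T(x,D)U=0$ in $A_{\text{Baire I}}(X)$, and the restriction of $U$ to $X\setminus\Sigma$ is $\psi$; 4. $U=s+\mathcal{J}(X)\in B_{\text{Baire I}}(X)$ is a global generalized solution: $T(x,D)U=0$ in $B_{\text{Baire I}}(X)$, and the restriction of $U$ to $X\setminus\Sigma$ is $\psi$. -/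

import Mathlib

open Set Filter Topology MeasureTheory TopologicalSpace
open scoped ContDiff

namespace FoamAlgebra

noncomputable section

/-- Space-time `ℝⁿ = ℝ × ℝ^d`, `n = d + 1`, with points `x = (t, y)`. -/
abbrev Pt (d : ℕ) : Type := ℝ × (Fin d → ℝ)

variable {d : ℕ}

/-! ### Partial derivatives -/

/-- Directional derivative `∂_v f`. -/
def dirDeriv (v : Pt d) (f : Pt d → ℂ) : Pt d → ℂ := fun x => fderiv ℝ f x v

/-- `D_t`. -/
def Dt (f : Pt d → ℂ) : Pt d → ℂ := dirDeriv (1, 0) f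

/-- `D_{y_i}`. -/
def Dy (i : Fin d) (f : Pt d → ℂ) : Pt d → ℂ := dirDeriv (0, Pi.single i 1) f

/-- `D_t^p D_y^q f = D_t^p D_{y_1}^{q_1} ⋯ D_{y_d}^{q_d} f`. -/
def partialD (p : ℕ) (q : Fin d → ℕ) (f : Pt d → ℂ) : Pt d → ℂ :=
  Dt^[p] ((List.finRange d).foldr (fun i g => (Dy i)^[q i] g) f)

/-- Successive directional derivatives along a list of vectors. -/
def listD (l : List (Pt d)) (f : Pt d → ℂ) : Pt d → ℂ := l.foldr dirDeriv f

/-- The list of coordinate vectors along which `D_t^p D_y^q` differentiates. -/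
def dirList (p : ℕ) (q : Fin d → ℕ) : List (Pt d) :=
  List.replicate p (1, 0) ++
    (List.finRange d).flatMap fun i => List.replicate (q i) (0, Pi.single i 1)

lemma listD_append (l l' : List (Pt d)) (f : Pt d → ℂ) :
    listD (l ++ l') f = listD l (listD l' f) := by
  simp [listD, List.foldr_append]

lemma listD_replicate (k : ℕ) (v : Pt d) (f : Pt d → ℂ) :
    listD (List.replicate k v) f = (dirDeriv v)^[k] f := by
  induction k with
  | zero => rfl
  | succ k ih =>
    rw [List.replicate_succ, Function.iterate_succ_apply', ← ih]; rfl

lemma partialD_eq_listD (p : ℕ) (q : Fin d → ℕ) (f : Pt d → ℂ) :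
    partialD p q f = listD (dirList p q) f := by
  have h : ∀ L : List (Fin d), L.foldr (fun i g => (Dy i)^[q i] g) f =
      listD (L.flatMap fun i => List.replicate (q i) (0, Pi.single i 1)) f := by
    intro L
    induction L with
    | nil => rfl
    | cons a L ih =>
      rw [List.foldr_cons, ih, List.flatMap_cons, listD_append, listD_replicate]; rfl
  rw [partialD, dirList, listD_append, listD_replicate, h]; rfl

lemma listD_congr {f g : Pt d → ℂ} {x : Pt d} (h : f =ᶠ[𝓝 x] g) (l : List (Pt d)) :
    listD l f =ᶠ[𝓝 x] listD l g := by
  induction l with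
  | nil => exact h
  | cons v l ih =>
    have := ih.fderiv (𝕜 := ℝ)
    filter_upwards [this] with y hy
    change fderiv ℝ (listD l f) y v = fderiv ℝ (listD l g) y v
    rw [hy]

lemma listD_contDiffAt {f : Pt d → ℂ} {x : Pt d} (hf : ContDiffAt ℝ ∞ f x) (l : List (Pt d)) :
    ContDiffAt ℝ ∞ (listD l f) x := by
  induction l with
  | nil => exact hf
  | cons v l ih =>
    have : ContDiffAt ℝ ∞ (fderiv ℝ (listD l f)) x := ih.fderiv_right (by simp)
    exact this.clm_apply contDiffAt_const

lemma eventually_smooth {f : Pt d → ℂ} {x : Pt d} (hf : ∀ᶠ y in 𝓝 x, ContDiffAt ℝ ∞ f y)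
    (l : List (Pt d)) : ∀ᶠ y in 𝓝 x, ContDiffAt ℝ ∞ (listD l f) y :=
  hf.mono fun _ hy => listD_contDiffAt hy l

lemma listD_eq_iteratedFDeriv {f : Pt d → ℂ} (l : List (Pt d)) : ∀ {x : Pt d},
    (∀ᶠ y in 𝓝 x, ContDiffAt ℝ ∞ f y) →
    listD l f x = iteratedFDeriv ℝ l.length f x l.get := by
  induction l with
  | nil => intro x _; simp [listD]
  | cons v l ih =>
    intro x hf
    have h1 : listD l f =ᶠ[𝓝 x] fun y => iteratedFDeriv ℝ l.length f y l.get :=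
      hf.eventually_nhds.mono fun y hy => ih hy
    change fderiv ℝ (listD l f) x v = _
    rw [h1.fderiv_eq]
    have h2 : DifferentiableAt ℝ (iteratedFDeriv ℝ l.length f) x :=
      hf.self_of_nhds.differentiableAt_iteratedFDeriv (by
        exact_mod_cast WithTop.coe_lt_coe.2 (ENat.natCast_lt_top _))
    have h3 := fderiv_continuousMultilinear_apply_const_apply (𝕜 := ℝ) h2 l.get v
    rw [h3]
    rfl

lemma listD_sub {f g : Pt d → ℂ} (l : List (Pt d)) : ∀ {x : Pt d},
    (∀ᶠ y in 𝓝 x, ContDiffAt ℝ ∞ f y) → (∀ᶠ y in 𝓝 x, ContDiffAt ℝ ∞ g y) →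
    listD l (f - g) x = listD l f x - listD l g x := by
  induction l with
  | nil => intros; rfl
  | cons v l ih =>
    intro x hf hg
    have h1 : listD l (f - g) =ᶠ[𝓝 x] listD l f - listD l g :=
      (hf.eventually_nhds.and hg.eventually_nhds).mono fun y hy => ih hy.1 hy.2
    change fderiv ℝ (listD l (f - g)) x v = fderiv ℝ (listD l f) x v - fderiv ℝ (listD l g) x v
    rw [h1.fderiv_eq, fderiv_sub]
    · rfl
    · exact (listD_contDiffAt hf.self_of_nhds l).differentiableAt (by simp)
    · exact (listD_contDiffAt hg.self_of_nhds l).differentiableAt (by simp)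

lemma listD_perm {f : Pt d → ℂ} {l l' : List (Pt d)} (h : l.Perm l') : ∀ {x : Pt d},
    (∀ᶠ y in 𝓝 x, ContDiffAt ℝ ∞ f y) → listD l f x = listD l' f x := by
  induction h with
  | nil => intros; rfl
  | cons v _ ih =>
    intro x hf
    have h1 : listD _ f =ᶠ[𝓝 x] listD _ f := hf.eventually_nhds.mono fun y hy => ih hy
    change fderiv ℝ (listD _ f) x v = fderiv ℝ (listD _ f) x v
    rw [h1.fderiv_eq]
  | swap v w l =>
    intro x hf
    have hs := eventually_smooth hf l
    have hx := hs.self_of_nhds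
    have hd : DifferentiableAt ℝ (fderiv ℝ (listD l f)) x :=
      (hx.fderiv_right (m := ∞) (by simp)).differentiableAt (by simp)
    have key : ∀ a b : Pt d, fderiv ℝ (fun y => fderiv ℝ (listD l f) y a) x b =
        fderiv ℝ (fderiv ℝ (listD l f)) x b a := by
      intro a b
      rw [fderiv_clm_apply hd (differentiableAt_const a)]
      simp
    change fderiv ℝ (fun y => fderiv ℝ (listD l f) y v) x w =
      fderiv ℝ (fun y => fderiv ℝ (listD l f) y w) x v
    rw [key, key]
    exact (hx.isSymmSndFDerivAt (by
      rw [minSmoothness_of_isRCLikeNormedField]; exact WithTop.coe_le_coe.2 le_top)).eq w v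
  | trans _ _ ih1 ih2 => intro x hf; rw [ih1 hf, ih2 hf]

/-- The coordinate vectors, indexed by `Unit ⊕ Fin d`. -/
def coordVec : Unit ⊕ Fin d → Pt d
  | Sum.inl _ => (1, 0)
  | Sum.inr i => (0, Pi.single i 1)

lemma exists_perm_dirList (L : List (Unit ⊕ Fin d)) :
    ∃ p q, (L.map coordVec).Perm (dirList p q) := by
  have : LawfulBEq (Unit ⊕ Fin d) :=
    { eq_of_beq := by
        rintro (a | a) (b | b) h
        · rfl
        · cases h
        · cases h
        · exact congrArg Sum.inr (eq_of_beq (α := Fin d) h)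
      rfl := by
        rintro (a | a)
        · rfl
        · exact beq_self_eq_true (α := Fin d) a }
  refine ⟨L.count (Sum.inl ()), fun i => L.count (Sum.inr i), ?_⟩
  have h : L.Perm (List.replicate (L.count (Sum.inl ())) (Sum.inl ()) ++
      (List.finRange d).flatMap fun i => List.replicate (L.count (Sum.inr i)) (Sum.inr i)) := by
    rw [List.perm_iff_count]
    rintro (⟨⟩ | j)
    · simp [List.count_append, List.count_replicate, List.count_flatMap, Function.comp_def]
    · simp [List.count_append, List.count_replicate, List.count_flatMap, Function.comp_def,
        ← List.ofFn_eq_map, List.sum_ofFn]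
  have h2 := h.map coordVec
  simpa [dirList, List.map_flatMap, coordVec, List.map_replicate] using h2

lemma multilinear_zero {k : ℕ} (M : ContinuousMultilinearMap ℝ (fun _ : Fin k => Pt d) ℂ)
    (h : ∀ c : Fin k → Unit ⊕ Fin d, M (fun i => coordVec (c i)) = 0) : M = 0 := by
  let b : Module.Basis (Unit ⊕ Fin d) ℝ (Pt d) :=
    (Module.Basis.singleton Unit ℝ).prod (Pi.basisFun ℝ (Fin d))
  have hb : ∀ c, b c = coordVec c := by
    rintro (⟨⟩ | i)
    · simp [b, coordVec]
    · simp [b, coordVec]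
  apply ContinuousMultilinearMap.toMultilinearMap_injective
  apply Module.Basis.ext_multilinear (fun _ => b)
  intro c
  simpa [hb] using h c

/-- All partial derivatives of a smooth function vanish at a point iff all its iterated Fréchet
derivatives vanish there. -/
lemma flat_iff {f : Pt d → ℂ} {x : Pt d} (hf : ∀ᶠ y in 𝓝 x, ContDiffAt ℝ ∞ f y) :
    (∀ p q, partialD p q f x = 0) ↔ ∀ k, iteratedFDeriv ℝ k f x = 0 := by
  constructor
  · intro h k
    apply multilinear_zero
    intro c
    obtain ⟨p, q, hpq⟩ := exists_perm_dirList (List.ofFn c)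
    have h1 := listD_perm hpq hf
    rw [← partialD_eq_listD, h, List.map_ofFn] at h1
    have h2 := listD_eq_iteratedFDeriv (List.ofFn (coordVec ∘ c)) hf
    rw [h1] at h2
    have : ∀ (l : List (Pt d)) (n : ℕ) (hn : l.length = n),
        iteratedFDeriv ℝ l.length f x l.get =
          iteratedFDeriv ℝ n f x (fun i => l.get (Fin.cast hn.symm i)) := by
      rintro l n rfl; rfl
    rw [this _ k (by simp)] at h2
    rw [h2]
    congr 1
    ext i <;> simp
  · intro h p q
    rw [partialD_eq_listD, listD_eq_iteratedFDeriv _ hf, h]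
    rfl

/-! ### Smooth functions on an open set -/

/-- Extension by zero of a function on `X`. -/
def extZero {X : Opens (Pt d)} (f : X → ℂ) : Pt d → ℂ := Function.extend Subtype.val f 0

lemma extZero_apply {X : Opens (Pt d)} (f : X → ℂ) (x : X) : extZero f x = f x :=
  Subtype.val_injective.extend_apply f 0 x

lemma extZero_apply' {X : Opens (Pt d)} (f : X → ℂ) {x : Pt d} (hx : x ∈ X) :
    extZero f x = f ⟨x, hx⟩ := extZero_apply f ⟨x, hx⟩

/-- The algebra `C^∞(X)` of smooth complex-valued functions on the open set `X`. -/
def Smooth (X : Opens (Pt d)) : Subalgebra ℂ (X → ℂ) where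
  carrier := {f | ContDiffOn ℝ ∞ (extZero f) X}
  mul_mem' := by
    intro f g hf hg
    refine (ContDiffOn.mul hf hg).congr fun x hx => ?_
    simp only [Pi.mul_apply, extZero_apply' _ hx]
  add_mem' := by
    intro f g hf hg
    refine (ContDiffOn.add hf hg).congr fun x hx => ?_
    simp only [Pi.add_apply, extZero_apply' _ hx]
  algebraMap_mem' := by
    intro r
    refine (contDiffOn_const (c := r)).congr fun x hx => ?_
    simp only [extZero_apply' _ hx]
    rfl

/-- A function that is smooth on `X`, as an element of `C^∞(X)`. -/
def toSmooth {X : Opens (Pt d)} (F : Pt d → ℂ) (hF : ContDiffOn ℝ ∞ F X) : Smooth X :=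
  ⟨fun x => F x, hF.congr fun _ hx => extZero_apply' _ hx⟩

lemma smooth_contDiffAt {X : Opens (Pt d)} (f : Smooth X) {x : Pt d} (hx : x ∈ X) :
    ContDiffAt ℝ ∞ (extZero f.1) x :=
  ContDiffOn.contDiffAt f.2 (X.isOpen.mem_nhds hx)

lemma smooth_eventually {X : Opens (Pt d)} (f : Smooth X) {x : Pt d} (hx : x ∈ X) :
    ∀ᶠ y in 𝓝 x, ContDiffAt ℝ ∞ (extZero f.1) y :=
  (show ∀ᶠ y in 𝓝 x, y ∈ X from X.isOpen.mem_nhds hx).mono fun _ hy => smooth_contDiffAt f hy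

lemma extZero_sub_eventuallyEq {X : Opens (Pt d)} (f g : Smooth X) {x : Pt d} (hx : x ∈ X) :
    extZero (f - g).1 =ᶠ[𝓝 x] extZero f.1 - extZero g.1 :=
  (show ∀ᶠ y in 𝓝 x, y ∈ X from X.isOpen.mem_nhds hx).mono fun y hy => by
    rw [Pi.sub_apply, extZero_apply' _ hy, extZero_apply' _ hy, extZero_apply' _ hy]; rfl

/-- Restriction `C^∞(X) → C^∞(Y)` for open `Y ⊆ X`. -/
def restrictSmooth {X Y : Opens (Pt d)} (h : Y ≤ X) : Smooth X →+* Smooth Y where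
  toFun f := ⟨fun y => f.1 ⟨y.1, h y.2⟩, (ContDiffOn.mono f.2 h).congr fun x hx => by
    rw [extZero_apply' _ hx, extZero_apply' _ (h hx)]⟩
  map_one' := rfl
  map_mul' _ _ := rfl
  map_zero' := rfl
  map_add' _ _ := rfl

lemma extZero_restrictSmooth {X Y : Opens (Pt d)} (h : Y ≤ X) (f : Smooth X) {x : Pt d} (hx : x ∈ Y) :
    extZero (restrictSmooth h f).1 =ᶠ[𝓝 x] extZero f.1 :=
  (show ∀ᶠ y in 𝓝 x, y ∈ Y from Y.isOpen.mem_nhds hx).mono fun y hy => by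
    rw [extZero_apply' _ hy, extZero_apply' _ (h hy)]; rfl

/-! ### The nonlinear partial differential operator -/

/-- The indices `(p, q)` with `p < m` and `p + |q| ≤ m` (so that `q_i ≤ m` for every `i`). -/
abbrev JetIndex (d m : ℕ) : Type :=
  {a : Fin m × (Fin d → Fin (m + 1)) // (a.1 : ℕ) + ∑ i, (a.2 i : ℕ) ≤ m}

/-- The point `(t, y, …, D_t^p D_y^q f(t, y), …)`. -/
def jet (m : ℕ) (f : Pt d → ℂ) (x : Pt d) : Pt d × (JetIndex d m → ℂ) :=
  (x, fun a => partialD (a.1.1 : ℕ) (fun i => (a.1.2 i : ℕ)) f x)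

/-- `T(x, D) f = D_t^m f - G(t, y, …, D_t^p D_y^q f, …)`, for functions on `ℝⁿ`. -/
def opFun (m : ℕ) (G : Pt d × (JetIndex d m → ℂ) → ℂ) (f : Pt d → ℂ) : Pt d → ℂ :=
  fun x => partialD m 0 f x - G (jet m f x)

lemma opFun_congr {m : ℕ} {G : Pt d × (JetIndex d m → ℂ) → ℂ} {f g : Pt d → ℂ} {x : Pt d}
    (h : f =ᶠ[𝓝 x] g) : opFun m G f x = opFun m G g x := by
  have h1 : ∀ p q, partialD p q f x = partialD p q g x := fun p q => by
    rw [partialD_eq_listD, partialD_eq_listD]; exact (listD_congr h _).self_of_nhds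
  simp only [opFun, jet, h1]

lemma jet_contDiffAt {m : ℕ} {f : Pt d → ℂ} {x : Pt d} (hf : ContDiffAt ℝ ∞ f x) :
    ContDiffAt ℝ ∞ (jet m f) x := by
  refine contDiffAt_id.prodMk (contDiffAt_pi.2 fun a => ?_)
  rw [partialD_eq_listD]
  exact listD_contDiffAt hf _

lemma op_smooth {X : Opens (Pt d)} {m : ℕ} {G : Pt d × (JetIndex d m → ℂ) → ℂ}
    (hG : AnalyticOnNhd ℝ G ((X : Set (Pt d)) ×ˢ univ)) (f : Smooth X) :
    ContDiffOn ℝ ∞ (opFun m G (extZero f.1)) X := by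
  intro x hx
  refine ContDiffAt.contDiffWithinAt ?_
  refine ContDiffAt.sub ?_ ?_
  · rw [partialD_eq_listD]
    exact listD_contDiffAt (smooth_contDiffAt f hx) _
  · have h1 : ContDiffAt ℝ ∞ G (jet m (extZero f.1) x) := (hG _ ⟨hx, mem_univ _⟩).contDiffAt
    exact h1.comp x (jet_contDiffAt (smooth_contDiffAt f hx))

/-- The mapping `T(x, D) : C^∞(X) → C^∞(X)`. -/
def op {X : Opens (Pt d)} {m : ℕ} {G : Pt d × (JetIndex d m → ℂ) → ℂ}
    (hG : AnalyticOnNhd ℝ G ((X : Set (Pt d)) ×ˢ univ)) (f : Smooth X) : Smooth X :=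
  toSmooth (opFun m G (extZero f.1)) (op_smooth hG f)

lemma extZero_op {X : Opens (Pt d)} {m : ℕ} {G : Pt d × (JetIndex d m → ℂ) → ℂ}
    (hG : AnalyticOnNhd ℝ G ((X : Set (Pt d)) ×ˢ univ)) (f : Smooth X) {x : Pt d} (hx : x ∈ X) :
    extZero (op hG f).1 =ᶠ[𝓝 x] opFun m G (extZero f.1) :=
  (show ∀ᶠ y in 𝓝 x, y ∈ X from X.isOpen.mem_nhds hx).mono fun _ hy => extZero_apply' _ hy

lemma flat_listD {f : Pt d → ℂ} {x : Pt d} (hf : ∀ᶠ y in 𝓝 x, ContDiffAt ℝ ∞ f y)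
    (h : ∀ k, iteratedFDeriv ℝ k f x = 0) (l : List (Pt d)) (k : ℕ) :
    iteratedFDeriv ℝ k (listD l f) x = 0 := by
  revert k
  rw [← flat_iff (eventually_smooth hf l)]
  intro p q
  rw [partialD_eq_listD, ← listD_append, listD_eq_iteratedFDeriv _ hf, h]
  rfl

lemma op_flat {X : Opens (Pt d)} {m : ℕ} {G : Pt d × (JetIndex d m → ℂ) → ℂ}
    (hG : AnalyticOnNhd ℝ G ((X : Set (Pt d)) ×ˢ univ)) {f g : Smooth X} {x : Pt d} (hx : x ∈ X)
    (h : ∀ p q, partialD p q (extZero (f - g).1) x = 0) (p : ℕ) (q : Fin d → ℕ) :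
    partialD p q (extZero (op hG f - op hG g).1) x = 0 := by
  revert p q
  rw [flat_iff (smooth_eventually (f - g) hx)] at h
  rw [flat_iff (smooth_eventually (op hG f - op hG g) hx)]
  have hfg : ∀ (l : List (Pt d)) (k : ℕ), iteratedFDeriv ℝ k (listD l (extZero f.1)) x =
      iteratedFDeriv ℝ k (listD l (extZero g.1)) x := by
    intro l k
    have h1 := flat_listD (smooth_eventually (f - g) hx) h l k
    have h2 : listD l (extZero (f - g).1) =ᶠ[𝓝 x] listD l (extZero f.1) - listD l (extZero g.1) := by
      filter_upwards [listD_congr (extZero_sub_eventuallyEq f g hx) l, X.isOpen.mem_nhds hx]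
        with y hy hyX
      rw [hy, listD_sub l (smooth_eventually f hyX) (smooth_eventually g hyX)]; rfl
    rw [(h2.iteratedFDeriv ℝ k).self_of_nhds, iteratedFDeriv_sub_apply
      ((listD_contDiffAt (smooth_contDiffAt f hx) l).of_le (by exact_mod_cast le_top))
      ((listD_contDiffAt (smooth_contDiffAt g hx) l).of_le (by exact_mod_cast le_top))] at h1
    exact sub_eq_zero.1 h1
  have hjet : ∀ k, iteratedFDeriv ℝ k (jet m (extZero f.1)) x =
      iteratedFDeriv ℝ k (jet m (extZero g.1)) x := by
    intro k
    have hk : (k : ℕ∞ω) ≤ ∞ := by exact_mod_cast le_top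
    have hp : ∀ u : Smooth X, ∀ a : JetIndex d m, ContDiffAt ℝ k
        (fun y => partialD (a.1.1 : ℕ) (fun i => (a.1.2 i : ℕ)) (extZero u.1) y) x := by
      intro u a
      rw [partialD_eq_listD]
      exact (listD_contDiffAt (smooth_contDiffAt u hx) _).of_le hk
    have e : ∀ u : Smooth X, iteratedFDeriv ℝ k (jet m (extZero u.1)) x =
        (iteratedFDeriv ℝ k (fun y : Pt d => y) x).prod (iteratedFDeriv ℝ k
          (fun y => fun a : JetIndex d m =>
            partialD (a.1.1 : ℕ) (fun i => (a.1.2 i : ℕ)) (extZero u.1) y) x) := by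
      intro u
      exact iteratedFDeriv_prodMk contDiffAt_id (contDiffAt_pi.2 (hp u)) le_rfl
    have e2 : ∀ (u : Smooth X) (a : JetIndex d m) (v : Fin k → Pt d), iteratedFDeriv ℝ k
          (fun y => fun a : JetIndex d m =>
            partialD (a.1.1 : ℕ) (fun i => (a.1.2 i : ℕ)) (extZero u.1) y) x v a =
          iteratedFDeriv ℝ k (fun y =>
            partialD (a.1.1 : ℕ) (fun i => (a.1.2 i : ℕ)) (extZero u.1) y) x v := by
      intro u a v
      have := (ContinuousLinearMap.proj (R := ℝ) (φ := fun _ : JetIndex d m => ℂ)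
        a).iteratedFDeriv_comp_left (contDiffAt_pi.2 (hp u)) (i := k) le_rfl
      exact (congrArg (fun M => M v) this).symm
    rw [e, e]
    congr 1
    ext v a
    rw [e2, e2]
    have := hfg (dirList (a.1.1 : ℕ) (fun i => (a.1.2 i : ℕ))) k
    rw [← partialD_eq_listD, ← partialD_eq_listD] at this
    exact congrArg (fun M => M v) this
  intro k
  have hk : (k : ℕ∞ω) ≤ ∞ := by exact_mod_cast le_top
  have hcomp : ∀ u : Smooth X, iteratedFDeriv ℝ k (fun y => G (jet m (extZero u.1) y)) x =
      (ftaylorSeries ℝ G (jet m (extZero u.1) x)).taylorComp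
        (ftaylorSeries ℝ (jet m (extZero u.1)) x) k := by
    intro u
    have h1 : ContDiffAt ℝ ∞ G (jet m (extZero u.1) x) := (hG _ ⟨hx, mem_univ _⟩).contDiffAt
    exact iteratedFDeriv_comp h1 (jet_contDiffAt (smooth_contDiffAt u hx)) hk
  have hG' : ∀ u : Smooth X, ContDiffAt ℝ k (fun y => G (jet m (extZero u.1) y)) x := by
    intro u
    have h1 : ContDiffAt ℝ ∞ G (jet m (extZero u.1) x) := (hG _ ⟨hx, mem_univ _⟩).contDiffAt
    exact (h1.comp x (jet_contDiffAt (smooth_contDiffAt u hx))).of_le hk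
  have hD : ∀ u : Smooth X, ContDiffAt ℝ k (partialD m 0 (extZero u.1)) x := by
    intro u
    rw [partialD_eq_listD]
    exact (listD_contDiffAt (smooth_contDiffAt u hx) _).of_le hk
  have hop : ∀ u : Smooth X, iteratedFDeriv ℝ k (extZero (op hG u).1) x =
      iteratedFDeriv ℝ k (partialD m 0 (extZero u.1)) x -
        iteratedFDeriv ℝ k (fun y => G (jet m (extZero u.1) y)) x := by
    intro u
    rw [((extZero_op hG u hx).iteratedFDeriv ℝ k).self_of_nhds]
    exact iteratedFDeriv_sub_apply (hD u) (hG' u)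
  rw [((extZero_sub_eventuallyEq (op hG f) (op hG g) hx).iteratedFDeriv ℝ k).self_of_nhds,
    iteratedFDeriv_sub_apply ((smooth_contDiffAt (op hG f) hx).of_le hk)
      ((smooth_contDiffAt (op hG g) hx).of_le hk), hop, hop, hcomp, hcomp]
  have hs : ftaylorSeries ℝ (jet m (extZero f.1)) x = ftaylorSeries ℝ (jet m (extZero g.1)) x :=
    funext hjet
  have h0 : jet m (extZero f.1) x = jet m (extZero g.1) x := by
    have := congrArg (fun M => M 0) (hjet 0)
    simpa using this
  rw [hs, h0, partialD_eq_listD, partialD_eq_listD, hfg, sub_self]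

/-! ### The ideals of asymptotically vanishing sequences -/

/-- Condition defining `𝒥_{ℕ, Sg}(X)`: at each point outside `Sg`, all the partial derivatives of
all the terms, from a certain index on, vanish. -/
def VanishesJ {X : Opens (Pt d)} (Sg : Set X) (w : ℕ → Smooth X) : Prop :=
  ∀ x ∉ Sg, ∃ l : ℕ, ∀ k ≥ l, ∀ (p : ℕ) (q : Fin d → ℕ), partialD p q (extZero (w k).1) x = 0

/-- The representations `Sg = limsup_k S_k = ⋂_l ⋃_{k ≥ l} S_k` with closed sets `S_k ⊆ X`. -/
def IsLimsupRep {X : Opens (Pt d)} (Sg : Set X) (S : ℕ → Set X) : Prop :=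
  (∀ k, IsClosed (S k)) ∧ Sg = ⋂ l : ℕ, ⋃ k ≥ l, S k

/-- Condition defining `ℐ_{ℕ, Sg, S}(X)`: for each point outside `Sg`, each term, from a certain
index on, vanishes on an open neighbourhood of the point that is contained in `X \ S_k`. -/
def VanishesI {X : Opens (Pt d)} (Sg : Set X) (S : ℕ → Set X) (w : ℕ → Smooth X) : Prop :=
  ∀ x ∉ Sg, ∃ l : ℕ, ∀ k ≥ l, ∃ Δ : Set X, IsOpen Δ ∧ x ∈ Δ ∧ Δ ⊆ (S k)ᶜ ∧
    ∀ z ∈ Δ, (w k).1 z = 0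

/-- `𝒥_{Baire I}(X)`: the union of the `𝒥_{ℕ, Sg}(X)` over the sets `Sg` of first Baire category
in `X`. -/
def idealJ (X : Opens (Pt d)) : Ideal (ℕ → Smooth X) where
  carrier := {w | ∃ Sg : Set X, IsMeagre Sg ∧ VanishesJ Sg w}
  zero_mem' := by
    refine ⟨∅, IsMeagre.empty, fun x _ => ⟨0, fun k _ => ?_⟩⟩
    rw [flat_iff (smooth_eventually ((0 : ℕ → Smooth X) k) x.2)]
    intro j
    have : extZero ((0 : ℕ → Smooth X) k).1 = fun _ => (0 : ℂ) := by
      funext y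
      by_cases hy : y ∈ X
      · rw [extZero_apply' _ hy]; rfl
      · exact Function.extend_apply' _ _ _ (by rintro ⟨z, rfl⟩; exact hy z.2)
    rw [this, iteratedFDeriv_fun_zero]
    rfl
  add_mem' := by
    rintro u v ⟨A, hA, hu⟩ ⟨B, hB, hv⟩
    refine ⟨A ∪ B, hA.union hB, fun x hx => ?_⟩
    simp only [mem_union, not_or] at hx
    obtain ⟨a, ha⟩ := hu x hx.1
    obtain ⟨b, hb⟩ := hv x hx.2
    refine ⟨max a b, fun k hk => ?_⟩
    have h1 := ha k (le_trans (le_max_left _ _) hk)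
    have h2 := hb k (le_trans (le_max_right _ _) hk)
    rw [flat_iff (smooth_eventually (u k) x.2)] at h1
    rw [flat_iff (smooth_eventually (v k) x.2)] at h2
    rw [flat_iff (smooth_eventually ((u + v) k) x.2)]
    intro j
    have hj : (j : ℕ∞ω) ≤ ∞ := by exact_mod_cast le_top
    have e : extZero ((u + v) k).1 =ᶠ[𝓝 (x : Pt d)] extZero (u k).1 + extZero (v k).1 :=
      (show ∀ᶠ y in 𝓝 (x : Pt d), y ∈ X from X.isOpen.mem_nhds x.2).mono fun y hy => by
        rw [Pi.add_apply (extZero (u k).1), extZero_apply' _ hy, extZero_apply' (u k).1 hy,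
          extZero_apply' (v k).1 hy]; rfl
    rw [(e.iteratedFDeriv ℝ j).self_of_nhds, iteratedFDeriv_add_apply
      ((smooth_contDiffAt (u k) x.2).of_le hj) ((smooth_contDiffAt (v k) x.2).of_le hj), h1, h2, add_zero]
  smul_mem' := by
    rintro c w ⟨A, hA, hw⟩
    refine ⟨A, hA, fun x hx => ?_⟩
    obtain ⟨a, ha⟩ := hw x hx
    refine ⟨a, fun k hk => ?_⟩
    have h1 := ha k hk
    rw [flat_iff (smooth_eventually (w k) x.2)] at h1
    rw [flat_iff (smooth_eventually ((c • w) k) x.2)]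
    intro j
    have e : extZero ((c • w) k).1 =ᶠ[𝓝 (x : Pt d)] fun y => extZero (c k).1 y * extZero (w k).1 y :=
      (show ∀ᶠ y in 𝓝 (x : Pt d), y ∈ X from X.isOpen.mem_nhds x.2).mono fun y hy => by
        beta_reduce
        rw [extZero_apply' _ hy, extZero_apply' (c k).1 hy, extZero_apply' (w k).1 hy]; rfl
    rw [(e.iteratedFDeriv ℝ j).self_of_nhds, ← norm_le_zero_iff]
    rw [← iteratedFDerivWithin_of_isOpen j X.isOpen x.2]
    refine (norm_iteratedFDerivWithin_mul_le (N := ∞) (c k).2 (w k).2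
      X.isOpen.uniqueDiffOn x.2 (by exact_mod_cast le_top)).trans ?_
    refine (Finset.sum_eq_zero fun i _ => ?_).le
    rw [iteratedFDerivWithin_of_isOpen (j - i) X.isOpen x.2, h1, norm_zero, mul_zero]

/-- `ℐ_{Baire I}(X)`: the union of the `ℐ_{ℕ, Sg}(X)` over the (representable) sets `Sg` of first
Baire category in `X`. -/
def idealI (X : Opens (Pt d)) : Ideal (ℕ → Smooth X) where
  carrier := {w | ∃ (Sg : Set X) (S : ℕ → Set X), IsMeagre Sg ∧ IsLimsupRep Sg S ∧
    VanishesI Sg S w}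
  zero_mem' := by
    refine ⟨∅, fun _ => ∅, IsMeagre.empty, ⟨fun _ => isClosed_empty, by ext; simp⟩, fun x _ =>
      ⟨0, fun k _ => ⟨univ, isOpen_univ, mem_univ _, by simp, fun _ _ => rfl⟩⟩⟩
  add_mem' := by
    rintro u v ⟨A, S, hA, hS, hu⟩ ⟨B, R, hB, hR, hv⟩
    have hout : ∀ x, x ∉ ⋂ l : ℕ, ⋃ k ≥ l, (S k ∪ R k) → x ∉ A ∧ x ∉ B := by
      intro x hx
      rw [hS.2, hR.2]
      simp only [mem_iInter, mem_iUnion, mem_union, not_forall, not_exists, not_or] at hx ⊢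
      obtain ⟨l, hl⟩ := hx
      exact ⟨⟨l, fun k hk => (hl k hk).1⟩, ⟨l, fun k hk => (hl k hk).2⟩⟩
    have hin : (⋂ l : ℕ, ⋃ k ≥ l, (S k ∪ R k)) ⊆ A ∪ B := by
      intro x hx
      by_contra hc
      rw [mem_union, not_or, hS.2, hR.2] at hc
      simp only [mem_iInter, mem_iUnion, not_forall, not_exists] at hc
      obtain ⟨⟨a, ha⟩, ⟨b, hb⟩⟩ := hc
      have := mem_iInter.1 hx (max a b)
      simp only [mem_iUnion] at this
      obtain ⟨k, hk, h⟩ := this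
      rcases h with h | h
      · exact ha k (le_trans (le_max_left _ _) hk) h
      · exact hb k (le_trans (le_max_right _ _) hk) h
    refine ⟨_, fun k => S k ∪ R k, (hA.union hB).mono hin,
      ⟨fun k => (hS.1 k).union (hR.1 k), rfl⟩, fun x hx => ?_⟩
    obtain ⟨a, ha⟩ := hu x (hout x hx).1
    obtain ⟨b, hb⟩ := hv x (hout x hx).2
    refine ⟨max a b, fun k hk => ?_⟩
    obtain ⟨D, hD, hxD, hDS, hD0⟩ := ha k (le_trans (le_max_left _ _) hk)
    obtain ⟨E, hE, hxE, hER, hE0⟩ := hb k (le_trans (le_max_right _ _) hk)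
    refine ⟨D ∩ E, hD.inter hE, ⟨hxD, hxE⟩, ?_, fun z hz => ?_⟩
    · rintro z ⟨h1, h2⟩ (h | h)
      · exact hDS h1 h
      · exact hER h2 h
    · change (u k).1 z + (v k).1 z = 0
      rw [hD0 z hz.1, hE0 z hz.2, add_zero]
  smul_mem' := by
    rintro c w ⟨A, S, hA, hS, hw⟩
    refine ⟨A, S, hA, hS, fun x hx => ?_⟩
    obtain ⟨a, ha⟩ := hw x hx
    refine ⟨a, fun k hk => ?_⟩
    obtain ⟨D, hD, hxD, hDS, hD0⟩ := ha k hk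
    refine ⟨D, hD, hxD, hDS, fun z hz => ?_⟩
    change (c k).1 z * (w k).1 z = 0
    rw [hD0 z hz, mul_zero]

/-! ### The algebras of generalized functions -/

/-- The special multi-foam algebra `A_{Baire I}(X)`. -/
abbrev AlgA (X : Opens (Pt d)) : Type := (ℕ → Smooth X) ⧸ idealI X

/-- The multi-foam algebra `B_{Baire I}(X)`. -/
abbrev AlgB (X : Opens (Pt d)) : Type := (ℕ → Smooth X) ⧸ idealJ X

/-- The class `s + ℐ_{Baire I}(X)`. -/
def toA {X : Opens (Pt d)} (s : ℕ → Smooth X) : AlgA X := Ideal.Quotient.mk (idealI X) s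

/-- The class `s + 𝒥_{Baire I}(X)`. -/
def toB {X : Opens (Pt d)} (s : ℕ → Smooth X) : AlgB X := Ideal.Quotient.mk (idealJ X) s

/-- The embedding of `C^∞(X)` into `A_{Baire I}(X)` by constant sequences. -/
def embA {X : Opens (Pt d)} (f : Smooth X) : AlgA X := toA fun _ => f

/-- The embedding of `C^∞(X)` into `B_{Baire I}(X)` by constant sequences. -/
def embB {X : Opens (Pt d)} (f : Smooth X) : AlgB X := toB fun _ => f

lemma isMeagre_restrict {X Y : Opens (Pt d)} (h : Y ≤ X) {A : Set X} (hA : IsMeagre A) :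
    IsMeagre {y : Y | (⟨y.1, h y.2⟩ : X) ∈ A} :=
  hA.preimage_of_isOpenMap (f := fun y : Y => (⟨y.1, h y.2⟩ : X))
    (continuous_subtype_val.subtype_mk _) (Y.isOpen.isOpenMap_inclusion h)

/-- Restriction `A_{Baire I}(X) → A_{Baire I}(Y)`, termwise on sequences, for open `Y ⊆ X`. -/
def restrictA {X Y : Opens (Pt d)} (h : Y ≤ X) : AlgA X →+* AlgA Y :=
  Ideal.quotientMap (idealI Y) ((restrictSmooth h).compLeft ℕ) (by
    rintro w ⟨A, S, hA, hS, hw⟩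
    have hc : Continuous fun y : Y => (⟨y.1, h y.2⟩ : X) := continuous_subtype_val.subtype_mk _
    refine ⟨{y : Y | (⟨y.1, h y.2⟩ : X) ∈ A}, fun k => {y : Y | (⟨y.1, h y.2⟩ : X) ∈ S k},
      isMeagre_restrict h hA, ⟨fun k => (hS.1 k).preimage hc, ?_⟩, fun y hy => ?_⟩
    · ext y
      simp [hS.2]
    · obtain ⟨l, hl⟩ := hw _ hy
      refine ⟨l, fun k hk => ?_⟩
      obtain ⟨D, hD, hxD, hDS, hD0⟩ := hl k hk
      exact ⟨_, hD.preimage hc, hxD, fun z hz => hDS hz, fun z hz => hD0 _ hz⟩)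

/-- Restriction `B_{Baire I}(X) → B_{Baire I}(Y)`, termwise on sequences, for open `Y ⊆ X`. -/
def restrictB {X Y : Opens (Pt d)} (h : Y ≤ X) : AlgB X →+* AlgB Y :=
  Ideal.quotientMap (idealJ Y) ((restrictSmooth h).compLeft ℕ) (by
    rintro w ⟨A, hA, hw⟩
    refine ⟨{y : Y | (⟨y.1, h y.2⟩ : X) ∈ A}, isMeagre_restrict h hA, fun y hy => ?_⟩
    obtain ⟨l, hl⟩ := hw _ hy
    refine ⟨l, fun k hk p q => ?_⟩
    have h1 := hl k hk p q
    rw [partialD_eq_listD] at h1 ⊢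
    exact (listD_congr (extZero_restrictSmooth h (w k) y.2) _).self_of_nhds.trans h1)

/-- `T(x, D)` on `A_{Baire I}(X)`: `s + ℐ ↦ (T(x, D) s_k)_k + ℐ`. -/
def opA {X : Opens (Pt d)} {m : ℕ} {G : Pt d × (JetIndex d m → ℂ) → ℂ}
    (hG : AnalyticOnNhd ℝ G ((X : Set (Pt d)) ×ˢ univ)) (U : AlgA X) : AlgA X :=
  Quotient.liftOn' U (fun s => toA fun k => op hG (s k)) (by
    intro u v huv
    rw [Submodule.quotientRel_def] at huv
    obtain ⟨A, S, hA, hS, hw⟩ := huv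
    refine Ideal.Quotient.eq.2 ⟨A, S, hA, hS, fun x hx => ?_⟩
    obtain ⟨l, hl⟩ := hw x hx
    refine ⟨l, fun k hk => ?_⟩
    obtain ⟨D, hD, hxD, hDS, hD0⟩ := hl k hk
    refine ⟨D, hD, hxD, hDS, fun z hz => ?_⟩
    have hn : Subtype.val '' D ∈ 𝓝 (z : Pt d) :=
      (X.isOpen.isOpenMap_subtype_val D hD).mem_nhds ⟨z, hz, rfl⟩
    have e : extZero (u k).1 =ᶠ[𝓝 (z : Pt d)] extZero (v k).1 := by
      filter_upwards [hn]
      rintro _ ⟨y, hy, rfl⟩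
      rw [extZero_apply, extZero_apply]
      exact sub_eq_zero.1 (hD0 y hy)
    exact sub_eq_zero.2 (opFun_congr e))

/-- `T(x, D)` on `B_{Baire I}(X)`: `s + 𝒥 ↦ (T(x, D) s_k)_k + 𝒥`. -/
def opB {X : Opens (Pt d)} {m : ℕ} {G : Pt d × (JetIndex d m → ℂ) → ℂ}
    (hG : AnalyticOnNhd ℝ G ((X : Set (Pt d)) ×ˢ univ)) (U : AlgB X) : AlgB X :=
  Quotient.liftOn' U (fun s => toB fun k => op hG (s k)) (by
    intro u v huv
    rw [Submodule.quotientRel_def] at huv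
    obtain ⟨A, hA, hw⟩ := huv
    refine Ideal.Quotient.eq.2 ⟨A, hA, fun x hx => ?_⟩
    obtain ⟨l, hl⟩ := hw x hx
    exact ⟨l, fun k hk => op_flat hG x.2 (hl k hk)⟩)

/-! ### Complements of singularity sets -/

/-- The open set `X \ Sg`, for `Sg` closed in `X`. -/
def offSet (X : Opens (Pt d)) (Sg : Set X) (hSg : IsClosed Sg) : Opens (Pt d) :=
  ⟨Subtype.val '' Sgᶜ, X.isOpen.isOpenMap_subtype_val _ hSg.isOpen_compl⟩

lemma offSet_le (X : Opens (Pt d)) (Sg : Set X) (hSg : IsClosed Sg) : offSet X Sg hSg ≤ X := by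
  rintro _ ⟨x, _, rfl⟩
  exact x.2

end

end FoamAlgebra

open FoamAlgebra

/-!
The heart of the matter is the Cauchy–Kovalevskaya theorem, which is proved here by a contraction
in a Banach algebra of power series. Weight the monomial `t^k y^β` by `k! |β|! / (k + |β|)!`, the
inverse of a binomial coefficient. By Vandermonde's identity these weights are submultiplicative
(`wt_add_le`), so the power series with finite weighted `ℓ¹` norm form a Banach algebra `WAlg d`.
The point of the weights is that both `∂_t⁻¹` and `∂_t⁻¹ ∂_{y_i}` are bounded on it
(`wt_exchange_le`), while the elements still converge on a polydisc. With `v = D_t^m U` as the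
unknown and zero initial data, every derivative `D_t^p D_y^q U` entering `G` is the image of `v`
under a product of at most `m` such operators, at least one in number, and this product is as
small as desired after a rescaling of `t`. Substitution of algebra elements into the power series
of `G` is Lipschitz (`exists_substitution`), so the fully nonlinear equation `v = G(…)` has a
solution by Banach's fixed point theorem, without reduction to a first-order system
(`exists_local_solution`). Since `G` is only real-analytic in the complex variables `z_a`, it is
expanded in their real and imaginary parts, which make sense coefficientwise.

Two analytic solutions with the same data agree (`eqOn_of_initial_values`), so the local solutions
along the hyperplane `t = t₀` fit together to a solution on a neighbourhood of it. That
neighbourhood can be shrunk so that its boundary is a null set, since only countably many level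
sets of a function have positive measure (`exists_shrink_null_frontier`). The rest of `X` is
covered by a locally finite family of balls off the hyperplane, each of which carries some local
solution; off the boundaries of the balls one of these can be selected in a locally constant way
(`exists_solution_off_null`). The singularity set consists of the boundaries only: it is closed, of
measure zero, hence nowhere dense. Cutting the solution off near the singularity set gives smooth
functions on `X` that finally coincide with the solution near each point off the singularity set
(`exists_smooth_approx`), which is all that the ideals of generalized functions require.
-/

namespace FoamAlgebra

noncomputable section

variable {d m : ℕ}

/-! ### A weighted `ℓ¹` algebra of power series -/

/-- Multi-indices in the variables `t` (index `none`) and `y_i` (index `some i`). -/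
abbrev MIdx (d : ℕ) : Type := Option (Fin d) →₀ ℕ

/-- The weight `k! |β|! / (k + |β|)!` of the monomial `t^k y^β`. -/
def wt (a : MIdx d) : ℝ := ((a.degree.choose (a none) : ℕ) : ℝ)⁻¹

lemma apply_none_le_degree (a : MIdx d) : a none ≤ a.degree := Finsupp.le_degree none a

lemma wt_pos (a : MIdx d) : 0 < wt a :=
  inv_pos.2 (by exact_mod_cast Nat.choose_pos (apply_none_le_degree a))

lemma wt_zero : wt (0 : MIdx d) = 1 := by simp [wt]

/-- Submultiplicativity of the weights, from Vandermonde's identity. -/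
lemma wt_add_le (a b : MIdx d) : wt (a + b) ≤ wt a * wt b := by
  have hpos := mul_pos (wt_pos a) (wt_pos b)
  rw [wt, wt, wt, ← mul_inv] at *
  refine inv_anti₀ (inv_pos.1 (by simpa [wt, mul_comm] using hpos)) ?_
  rw [map_add, Finsupp.add_apply, Nat.add_choose_eq]
  exact_mod_cast Finset.single_le_sum (f := fun ij : ℕ × ℕ =>
      a.degree.choose ij.1 * b.degree.choose ij.2) (fun _ _ => Nat.zero_le _)
    ((Finset.HasAntidiagonal.mem_antidiagonal (a := (a none, b none))).2 rfl)

lemma half_pow_degree_le_wt (a : MIdx d) : (1 / 2 : ℝ) ^ a.degree ≤ wt a := by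
  rw [wt, one_div, inv_pow]
  refine inv_anti₀ (by exact_mod_cast Nat.choose_pos (apply_none_le_degree a)) ?_
  exact_mod_cast Nat.choose_le_two_pow _ _

/-- The terms of the weighted `ℓ¹` norm of a power series. -/
def wterm (f : MvPowerSeries (Option (Fin d)) ℂ) (a : MIdx d) : ℝ :=
  wt a * ‖MvPowerSeries.coeff a f‖

lemma wterm_nonneg (f : MvPowerSeries (Option (Fin d)) ℂ) (a : MIdx d) : 0 ≤ wterm f a :=
  mul_nonneg (wt_pos a).le (norm_nonneg _)

lemma wterm_add_le (f g : MvPowerSeries (Option (Fin d)) ℂ) (a : MIdx d) :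
    wterm (f + g) a ≤ wterm f a + wterm g a := by
  rw [wterm, wterm, wterm, ← mul_add, map_add]
  exact mul_le_mul_of_nonneg_left (norm_add_le _ _) (wt_pos a).le

lemma wterm_mul_le (f g : MvPowerSeries (Option (Fin d)) ℂ) (a : MIdx d) :
    wterm (f * g) a ≤ ∑ p ∈ Finset.HasAntidiagonal.antidiagonal a, wterm f p.1 * wterm g p.2 := by
  rw [wterm, MvPowerSeries.coeff_mul]
  refine (mul_le_mul_of_nonneg_left (norm_sum_le _ _) (wt_pos a).le).trans ?_
  rw [Finset.mul_sum]
  refine Finset.sum_le_sum fun p hp => ?_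
  rw [← Finset.HasAntidiagonal.mem_antidiagonal.1 hp, norm_mul]
  calc _ ≤ (wt p.1 * wt p.2) * (‖_‖ * ‖_‖) :=
        mul_le_mul_of_nonneg_right (wt_add_le _ _) (by positivity)
    _ = _ := by rw [wterm, wterm]; ring

lemma summable_wterm_mul {f g : MvPowerSeries (Option (Fin d)) ℂ} (hf : Summable (wterm f))
    (hg : Summable (wterm g)) :
    Summable fun a => ∑ p ∈ Finset.HasAntidiagonal.antidiagonal a, wterm f p.1 * wterm g p.2 :=
  summable_sum_mul_antidiagonal_of_summable_mul
    (hf.mul_of_nonneg hg (wterm_nonneg f) (wterm_nonneg g))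

/-- The power series with finite weighted `ℓ¹` norm, as a subalgebra of all power series. -/
def wSub (d : ℕ) : Subalgebra ℂ (MvPowerSeries (Option (Fin d)) ℂ) where
  carrier := {f | Summable (wterm f)}
  mul_mem' {f g} hf hg :=
    (summable_wterm_mul hf hg).of_nonneg_of_le (wterm_nonneg _) (wterm_mul_le f g)
  add_mem' {f g} hf hg :=
    (Summable.add hf hg).of_nonneg_of_le (wterm_nonneg _) (wterm_add_le f g)
  algebraMap_mem' r := by
    refine summable_of_ne_finset_zero (s := {0}) fun a ha => ?_
    rw [Finset.mem_singleton] at ha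
    rw [wterm, MvPowerSeries.algebraMap_apply, MvPowerSeries.coeff_C, if_neg ha, norm_zero,
      mul_zero]

/-- The algebra of power series `∑ c_a x^a` with `∑ wt a * ‖c_a‖ < ∞`. The weights make it a
Banach algebra on which both `∂_t⁻¹` and `∂_t⁻¹ ∂_{y_i}` are bounded. -/
def WAlg (d : ℕ) : Type := wSub d

-- The low priority lets instance search find these structures through the norm defined below.
instance (priority := 50) : CommRing (WAlg d) := inferInstanceAs (CommRing (wSub d))

instance (priority := 50) : Algebra ℂ (WAlg d) := inferInstanceAs (Algebra ℂ (wSub d))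

/-- The coefficients of an element of the weighted algebra. -/
def WAlg.coeff (f : WAlg d) (a : MIdx d) : ℂ := MvPowerSeries.coeff a f.1

namespace WAlg

lemma coeff_add (f g : WAlg d) (a : MIdx d) : (f + g).coeff a = f.coeff a + g.coeff a := rfl

lemma coeff_smul (c : ℂ) (f : WAlg d) (a : MIdx d) : (c • f).coeff a = c * f.coeff a := rfl

lemma coeff_one (a : MIdx d) : (1 : WAlg d).coeff a = if a = 0 then 1 else 0 :=
  MvPowerSeries.coeff_one a

lemma coeff_mul (f g : WAlg d) (a : MIdx d) :
    (f * g).coeff a = ∑ p ∈ Finset.HasAntidiagonal.antidiagonal a, f.coeff p.1 * g.coeff p.2 :=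
  MvPowerSeries.coeff_mul _ _ _

@[ext] lemma ext {f g : WAlg d} (h : ∀ a, f.coeff a = g.coeff a) : f = g :=
  Subtype.ext (MvPowerSeries.ext h)

lemma summable_coeff (f : WAlg d) : Summable fun a => wt a * ‖f.coeff a‖ := f.2

/-- The element of the weighted algebra with given coefficients. -/
def mk (c : MIdx d → ℂ) (hc : Summable fun a => wt a * ‖c a‖) : WAlg d :=
  ⟨c, hc⟩

@[simp] lemma coeff_mk (c : MIdx d → ℂ) (hc : Summable fun a => wt a * ‖c a‖) (a : MIdx d) :
    (mk c hc).coeff a = c a := rfl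

end WAlg

/-- The weighted `ℓ¹` norm. -/
def wNorm (d : ℕ) : RingNorm (WAlg d) where
  toFun f := ∑' a, wt a * ‖f.coeff a‖
  map_zero' := by
    have : ∀ a, (0 : WAlg d).coeff a = 0 := fun a => rfl
    simp [this]
  add_le' f g := by
    rw [← f.summable_coeff.tsum_add g.summable_coeff]
    exact (f + g).summable_coeff.tsum_le_tsum (wterm_add_le f.1 g.1)
      (f.summable_coeff.add g.summable_coeff)
  neg' f := by
    have : ∀ a, (-f).coeff a = -f.coeff a := fun a => rfl
    simp [this]
  mul_le' f g := by
    change ∑' a, wterm (f.1 * g.1) a ≤ (∑' a, wterm f.1 a) * ∑' a, wterm g.1 a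
    have hs := Summable.mul_of_nonneg f.2 g.2 (wterm_nonneg f.1) (wterm_nonneg g.1)
    rw [Summable.tsum_mul_tsum_eq_tsum_sum_antidiagonal f.2 g.2 hs]
    exact (f * g).2.tsum_le_tsum (wterm_mul_le f.1 g.1) (summable_wterm_mul f.2 g.2)
  eq_zero_of_map_eq_zero' f hf := by
    have h := (hasSum_zero_iff_of_nonneg (wterm_nonneg f.1)).1 (hf ▸ f.summable_coeff.hasSum)
    ext a
    have := congrFun h a
    exact norm_eq_zero.1 ((mul_eq_zero.1 this).resolve_left (wt_pos a).ne')

instance : NormedCommRing (WAlg d) :=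
  { (wNorm d).toNormedRing, (inferInstance : CommRing (WAlg d)) with }

namespace WAlg

lemma norm_def (f : WAlg d) : ‖f‖ = ∑' a, wt a * ‖f.coeff a‖ := rfl

instance : NormedAlgebra ℂ (WAlg d) where
  norm_smul_le c f := by
    rw [norm_def, norm_def, ← tsum_mul_left]
    refine le_of_eq (tsum_congr fun a => ?_)
    rw [coeff_smul, norm_mul]; ring

instance : NormOneClass (WAlg d) where
  norm_one := by
    rw [norm_def, tsum_eq_single 0]
    · simp [coeff_one, wt_zero]
    · intro a ha
      simp [coeff_one, ha]

/-- Multiplication of the coefficients by the weights identifies the weighted algebra with the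
unweighted `ℓ¹` space. -/
def toLp : WAlg d ≃ᵢ lp (fun _ : MIdx d => ℂ) 1 where
  toFun f := ⟨fun a => (wt a : ℂ) * f.coeff a, memℓp_gen (by
    simpa [abs_of_pos (wt_pos _)] using f.summable_coeff)⟩
  invFun g := mk (fun a => (wt a : ℂ)⁻¹ * g a) (by
    have h := (lp.memℓp g).summable (by simp)
    refine h.congr fun a => ?_
    have := (wt_pos a).ne'
    simp only [norm_mul, norm_inv, Complex.norm_real, Real.norm_of_nonneg (wt_pos a).le]
    simp [this])
  left_inv f := by
    ext a
    have := (wt_pos a).ne'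
    simp [this]
  right_inv g := by
    ext a
    have := (wt_pos a).ne'
    simp [this]
  isometry_toFun := by
    refine Isometry.of_dist_eq fun f g => ?_
    rw [dist_eq_norm, dist_eq_norm, lp.norm_eq_tsum_rpow (by simp), norm_def]
    simp only [ENNReal.toReal_one, Real.rpow_one, div_one]
    refine tsum_congr fun a => ?_
    have : (f - g).coeff a = f.coeff a - g.coeff a := rfl
    rw [this]
    change ‖(wt a : ℂ) * f.coeff a - (wt a : ℂ) * g.coeff a‖ = _
    rw [← mul_sub, norm_mul, Complex.norm_real, Real.norm_of_nonneg (wt_pos a).le]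

instance : CompleteSpace (WAlg d) :=
  (toLp (d := d)).isometry.isUniformInducing.completeSpace (by
    rw [(toLp (d := d)).range_eq_univ]; exact isComplete_univ)

end WAlg

/-! ### Integration and differentiation of power series -/

/-- The multi-index of a single variable. -/
abbrev unitIdx (j : Option (Fin d)) : MIdx d := Finsupp.single j 1

/-- Coefficients of the formal derivative in the variable `j`. -/
def derivCoeff (j : Option (Fin d)) (c : MIdx d → ℂ) (a : MIdx d) : ℂ :=
  ((a j : ℂ) + 1) * c (a + unitIdx j)

/-- Coefficients of the formal primitive in `t` that vanishes at `t = 0`. -/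
def intCoeff (c : MIdx d → ℂ) (a : MIdx d) : ℂ :=
  if a none = 0 then 0 else c (a - unitIdx none) / a none

lemma intCoeff_of_eq_zero (c : MIdx d → ℂ) {a : MIdx d} (ha : a none = 0) :
    intCoeff c a = 0 := if_pos ha

lemma intCoeff_add (c : MIdx d → ℂ) (a : MIdx d) :
    intCoeff c (a + unitIdx none) = c a / ((a none : ℂ) + 1) := by
  simp [intCoeff]

lemma exists_add_unitIdx {a : MIdx d} {j : Option (Fin d)} (ha : a j ≠ 0) :
    ∃ b, b + unitIdx j = a :=
  ⟨a - unitIdx j, tsub_add_cancel_of_le (by simpa [Nat.one_le_iff_ne_zero] using ha)⟩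

lemma add_unitIdx_injective (j : Option (Fin d)) :
    Function.Injective fun a : MIdx d => a + unitIdx j := add_left_injective _

lemma derivCoeff_intCoeff (c : MIdx d → ℂ) : derivCoeff none (intCoeff c) = c := by
  funext a
  rw [derivCoeff, intCoeff_add]
  have : (a none : ℂ) + 1 ≠ 0 := Nat.cast_add_one_ne_zero (a none)
  field_simp

lemma derivCoeff_some_intCoeff_add (i : Fin d) (c : MIdx d → ℂ) (a : MIdx d) :
    derivCoeff (some i) (intCoeff c) (a + unitIdx none) =
      ((a (some i) : ℂ) + 1) / ((a none : ℂ) + 1) * c (a + unitIdx (some i)) := by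
  rw [derivCoeff, add_right_comm, intCoeff_add]
  simp
  ring

/-- Differentiation in `y_i` commutes with integration in `t`. -/
lemma derivCoeff_some_intCoeff (i : Fin d) (c : MIdx d → ℂ) :
    derivCoeff (some i) (intCoeff c) = intCoeff (derivCoeff (some i) c) := by
  funext a
  by_cases ha : a none = 0
  · rw [intCoeff_of_eq_zero _ ha, derivCoeff, intCoeff_of_eq_zero, mul_zero]
    simpa using ha
  · obtain ⟨b, rfl⟩ := exists_add_unitIdx ha
    rw [derivCoeff_some_intCoeff_add, intCoeff_add, derivCoeff]
    ring

lemma wt_succ_none_le (a : MIdx d) :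
    wt (a + unitIdx none) ≤ wt a * ((a none : ℝ) + 1) := by
  have h1 : 0 < (a.degree.choose (a none) : ℝ) := by
    exact_mod_cast Nat.choose_pos (apply_none_le_degree a)
  have h2 : 0 < ((a.degree + 1).choose (a none + 1) : ℝ) := by
    exact_mod_cast Nat.choose_pos (Nat.succ_le_succ (apply_none_le_degree a))
  have h3 : ((a.degree.choose (a none) : ℕ) : ℝ) ≤
      ((a none : ℝ) + 1) * ((a.degree + 1).choose (a none + 1) : ℕ) := by
    have := Nat.add_one_mul_choose_eq a.degree (a none)
    have h4 : a.degree.choose (a none) ≤ (a none + 1) * (a.degree + 1).choose (a none + 1) := by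
      nlinarith
    exact_mod_cast h4
  rw [wt, wt, map_add, Finsupp.degree_single, Finsupp.add_apply, Finsupp.single_eq_same,
    inv_mul_eq_div, le_div_iff₀ h1, inv_mul_le_iff₀ h2]
  linarith

/-- The inequality of weights behind the boundedness of `∂_t⁻¹ ∂_{y_i}`. -/
lemma wt_exchange_le (a : MIdx d) (i : Fin d) :
    wt (a + unitIdx none) * (((a (some i) : ℝ) + 1) / ((a none : ℝ) + 1)) ≤
      wt (a + unitIdx (some i)) := by
  have hle : a none + a (some i) ≤ a.degree := by
    rw [Finsupp.degree_eq_sum, Fintype.sum_option]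
    exact Nat.add_le_add_left
      (Finset.single_le_sum (f := fun i => a (some i)) (fun _ _ => Nat.zero_le _)
        (Finset.mem_univ i)) _
  have h1 : 0 < ((a.degree + 1).choose (a none) : ℝ) := by
    exact_mod_cast Nat.choose_pos (by omega)
  have h2 : 0 < ((a.degree + 1).choose (a none + 1) : ℝ) := by
    exact_mod_cast Nat.choose_pos (Nat.succ_le_succ (apply_none_le_degree a))
  have h3 : ((a (some i) : ℝ) + 1) * ((a.degree + 1).choose (a none) : ℕ) ≤
      ((a none : ℝ) + 1) * ((a.degree + 1).choose (a none + 1) : ℕ) := by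
    have := Nat.choose_succ_right_eq (a.degree + 1) (a none)
    have h4 : (a (some i) + 1) * (a.degree + 1).choose (a none) ≤
        (a none + 1) * (a.degree + 1).choose (a none + 1) := by
      rw [mul_comm (a none + 1), this, mul_comm]
      exact Nat.mul_le_mul_left _ (by omega)
    exact_mod_cast h4
  have e1 : wt (a + unitIdx none) = ((a.degree + 1).choose (a none + 1) : ℝ)⁻¹ := by simp [wt]
  have e2 : wt (a + unitIdx (some i)) = ((a.degree + 1).choose (a none) : ℝ)⁻¹ := by simp [wt]
  rw [e1, e2, inv_mul_le_iff₀ h2, div_le_iff₀ (by positivity), ← div_eq_mul_inv, div_mul_eq_mul_div,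
    le_div_iff₀ h1]
  linarith

/-- If the coefficients `c` only involve monomials divisible by `t`, then weighted summability
and a bound for the weighted sum follow from a comparison after division by `t`. -/
lemma summable_of_shift {c : MIdx d → ℂ} {u : MIdx d → ℝ} (hc : ∀ a, a none = 0 → c a = 0)
    (hu : Summable u)
    (h : ∀ a, wt (a + unitIdx none) * ‖c (a + unitIdx none)‖ ≤ u a) :
    Summable (fun a => wt a * ‖c a‖) ∧ ∑' a, wt a * ‖c a‖ ≤ ∑' a, u a := by
  have hz : ∀ a ∉ range fun a : MIdx d => a + unitIdx none, wt a * ‖c a‖ = 0 := by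
    intro a ha
    rw [hc a, norm_zero, mul_zero]
    by_contra h0
    exact ha (exists_add_unitIdx h0)
  have hs : Summable ((fun a => wt a * ‖c a‖) ∘ fun a : MIdx d => a + unitIdx none) :=
    hu.of_nonneg_of_le (fun a => mul_nonneg (wt_pos _).le (norm_nonneg _)) h
  refine ⟨((add_unitIdx_injective none).summable_iff hz).1 hs, ?_⟩
  rw [← (add_unitIdx_injective none).tsum_eq (f := fun a => wt a * ‖c a‖)
    (fun a ha => by_contra fun h0 => ha (hz a h0))]
  exact hs.tsum_le_tsum h hu

lemma summable_intCoeff (f : WAlg d) :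
    Summable (fun a => wt a * ‖intCoeff f.coeff a‖) ∧
      ∑' a, wt a * ‖intCoeff f.coeff a‖ ≤ ‖f‖ := by
  refine summable_of_shift (fun a => intCoeff_of_eq_zero _) f.summable_coeff fun a => ?_
  have h0 : (0 : ℝ) < (a none : ℝ) + 1 := by positivity
  have hn : ‖(a none : ℂ) + 1‖ = (a none : ℝ) + 1 := by exact_mod_cast Complex.norm_natCast _
  rw [intCoeff_add, norm_div, hn, mul_div_assoc', div_le_iff₀ h0]
  calc _ ≤ (wt a * ((a none : ℝ) + 1)) * ‖f.coeff a‖ :=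
        mul_le_mul_of_nonneg_right (wt_succ_none_le a) (norm_nonneg _)
    _ = _ := by ring

lemma summable_derivCoeff_intCoeff (i : Fin d) (f : WAlg d) :
    Summable (fun a => wt a * ‖derivCoeff (some i) (intCoeff f.coeff) a‖) ∧
      ∑' a, wt a * ‖derivCoeff (some i) (intCoeff f.coeff) a‖ ≤ ‖f‖ := by
  have hs := f.summable_coeff.comp_injective (add_unitIdx_injective (some i))
  have h := summable_of_shift (c := derivCoeff (some i) (intCoeff f.coeff)) (fun a ha => by
    rw [derivCoeff_some_intCoeff, intCoeff_of_eq_zero _ ha]) hs fun a => by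
    have hn : ∀ n : ℕ, ‖(n : ℂ) + 1‖ = (n : ℝ) + 1 := fun n => by
      exact_mod_cast Complex.norm_natCast _
    rw [derivCoeff_some_intCoeff_add, norm_mul, norm_div, hn, hn, ← mul_assoc]
    exact mul_le_mul_of_nonneg_right (wt_exchange_le a i) (norm_nonneg _)
  exact ⟨h.1, h.2.trans (tsum_comp_le_tsum_of_inj f.summable_coeff
    (fun a => mul_nonneg (wt_pos a).le (norm_nonneg _)) (add_unitIdx_injective (some i)))⟩

namespace WAlg

/-- The bounded operator `∂_t⁻¹`: the primitive in `t` that vanishes at `t = 0`. -/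
def J : WAlg d →L[ℂ] WAlg d :=
  LinearMap.mkContinuous
    { toFun f := mk (intCoeff f.coeff) (summable_intCoeff f).1
      map_add' f g := by
        ext a
        simp only [coeff_mk, coeff_add, intCoeff]
        split_ifs <;> ring
      map_smul' c f := by
        ext a
        simp only [coeff_mk, coeff_smul, intCoeff, RingHom.id_apply]
        split_ifs <;> ring } 1
    fun f => by rw [one_mul]; exact (summable_intCoeff f).2

/-- The bounded operator `∂_{y_i} ∂_t⁻¹`. -/
def K (i : Fin d) : WAlg d →L[ℂ] WAlg d :=
  LinearMap.mkContinuous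
    { toFun f := mk (derivCoeff (some i) (intCoeff f.coeff)) (summable_derivCoeff_intCoeff i f).1
      map_add' f g := by
        ext a
        simp only [coeff_mk, coeff_add, intCoeff, derivCoeff]
        split_ifs <;> ring
      map_smul' c f := by
        ext a
        simp only [coeff_mk, coeff_smul, intCoeff, derivCoeff, RingHom.id_apply]
        split_ifs <;> ring } 1
    fun f => by rw [one_mul]; exact (summable_derivCoeff_intCoeff i f).2

lemma coeff_J (f : WAlg d) : (J f).coeff = intCoeff f.coeff := rfl

lemma coeff_K (i : Fin d) (f : WAlg d) : (K i f).coeff = derivCoeff (some i) (J f).coeff := rfl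

lemma J_K_comm (i : Fin d) : Commute (J : WAlg d →L[ℂ] WAlg d) (K i) := by
  refine ContinuousLinearMap.ext fun f => ?_
  change J (K i f) = K i (J f)
  ext a
  rw [coeff_J, coeff_K, coeff_K, coeff_J, coeff_J, coeff_J,
    derivCoeff_some_intCoeff (c := intCoeff _)]

lemma coeff_real_smul (r : ℝ) (f : WAlg d) (a : MIdx d) : (r • f).coeff a = r * f.coeff a := rfl

/-- The bounded operator given by a real-linear contraction of the coefficients. -/
def mapCoeff (L : ℂ →L[ℝ] ℂ) (hL : ∀ z, ‖L z‖ ≤ ‖z‖) : WAlg d →L[ℝ] WAlg d :=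
  have hs : ∀ f : WAlg d, Summable fun a => wt a * ‖L (f.coeff a)‖ := fun f =>
    f.summable_coeff.of_nonneg_of_le (fun a => mul_nonneg (wt_pos a).le (norm_nonneg _))
      fun a => mul_le_mul_of_nonneg_left (hL _) (wt_pos a).le
  LinearMap.mkContinuous
    { toFun f := mk (fun a => L (f.coeff a)) (hs f)
      map_add' f g := by
        ext a
        simp only [coeff_mk, coeff_add, map_add]
      map_smul' c f := by
        ext a
        simp only [coeff_mk, coeff_real_smul, RingHom.id_apply, ← Complex.real_smul, map_smul] } 1
    fun f => by
      rw [one_mul]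
      exact (hs f).tsum_le_tsum (fun a => mul_le_mul_of_nonneg_left (hL _) (wt_pos a).le)
        f.summable_coeff

lemma coeff_mapCoeff (L : ℂ →L[ℝ] ℂ) (hL : ∀ z, ‖L z‖ ≤ ‖z‖) (f : WAlg d) (a : MIdx d) :
    (mapCoeff L hL f).coeff a = L (f.coeff a) := rfl

/-- The power series of a coordinate function. -/
def X (j : Option (Fin d)) : WAlg d :=
  mk (fun a => if a = unitIdx j then 1 else 0) (by
    refine summable_of_ne_finset_zero (s := {unitIdx j}) fun a ha => ?_
    rw [Finset.mem_singleton] at ha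
    simp [ha])

/-! ### Evaluation of power series -/

/-- The value at `x` of the monomial with exponent `a`. -/
def mono (x : Option (Fin d) → ℝ) (a : MIdx d) : ℝ := ∏ j, x j ^ a j

lemma mono_add (x : Option (Fin d) → ℝ) (a b : MIdx d) :
    mono x (a + b) = mono x a * mono x b := by
  simp [mono, pow_add, Finset.prod_mul_distrib]

lemma mono_zero (x : Option (Fin d) → ℝ) : mono x 0 = 1 := by simp [mono]

lemma mono_unitIdx (x : Option (Fin d) → ℝ) (j : Option (Fin d)) : mono x (unitIdx j) = x j := by
  rw [mono, Finset.prod_eq_single j]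
  · simp
  · intro i _ hi
    simp [hi]
  · simp

lemma abs_mono_le {x : Option (Fin d) → ℝ} {r : ℝ} (hx : ∀ j, |x j| ≤ r) (a : MIdx d) :
    |mono x a| ≤ r ^ a.degree := by
  rw [mono, Finset.abs_prod, Finsupp.degree_eq_sum, ← Finset.prod_pow_eq_pow_sum]
  refine Finset.prod_le_prod (fun _ _ => abs_nonneg _) fun j _ => ?_
  rw [abs_pow]
  exact pow_le_pow_left₀ (abs_nonneg _) (hx j) _

lemma abs_mono_le_wt {x : Option (Fin d) → ℝ} (hx : ∀ j, |x j| ≤ 1 / 2) (a : MIdx d) :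
    |mono x a| ≤ wt a := (abs_mono_le hx a).trans (half_pow_degree_le_wt a)

/-- The value at `x` of a power series. -/
def ev (x : Option (Fin d) → ℝ) (f : WAlg d) : ℂ := ∑' a, mono x a • f.coeff a

section

variable {x : Option (Fin d) → ℝ} (hx : ∀ j, |x j| ≤ 1 / 2)
include hx

lemma norm_term_le (f : WAlg d) (a : MIdx d) : ‖mono x a • f.coeff a‖ ≤ wt a * ‖f.coeff a‖ := by
  rw [norm_smul, Real.norm_eq_abs]
  exact mul_le_mul_of_nonneg_right (abs_mono_le_wt hx a) (norm_nonneg _)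

lemma summable_norm_term (f : WAlg d) : Summable fun a => ‖mono x a • f.coeff a‖ :=
  f.summable_coeff.of_nonneg_of_le (fun _ => norm_nonneg _) (norm_term_le hx f)

lemma norm_ev_le (f : WAlg d) : ‖ev x f‖ ≤ ‖f‖ :=
  (norm_tsum_le_tsum_norm (summable_norm_term hx f)).trans
    ((summable_norm_term hx f).tsum_le_tsum (norm_term_le hx f) f.summable_coeff)

lemma ev_add (f g : WAlg d) : ev x (f + g) = ev x f + ev x g := by
  rw [ev, ev, ev, ← (summable_norm_term hx f).of_norm.tsum_add (summable_norm_term hx g).of_norm]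
  simp only [coeff_add, smul_add]

lemma ev_mul (f g : WAlg d) : ev x (f * g) = ev x f * ev x g := by
  have hs := summable_mul_of_summable_norm (summable_norm_term hx f) (summable_norm_term hx g)
  rw [ev, ev, ev, Summable.tsum_mul_tsum_eq_tsum_sum_antidiagonal
    (summable_norm_term hx f).of_norm (summable_norm_term hx g).of_norm hs]
  refine tsum_congr fun a => ?_
  rw [coeff_mul, Finset.smul_sum]
  refine Finset.sum_congr rfl fun p hp => ?_
  rw [← Finset.HasAntidiagonal.mem_antidiagonal.1 hp, mono_add]
  simp only [Complex.real_smul, Complex.ofReal_mul]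
  ring

omit hx in
lemma ev_one : ev x (1 : WAlg d) = 1 := by
  rw [ev, tsum_eq_single 0]
  · simp [coeff_one, mono_zero]
  · intro a ha
    simp [coeff_one, ha]

omit hx in
lemma ev_X (j : Option (Fin d)) : ev x (X j : WAlg d) = x j := by
  rw [ev, tsum_eq_single (unitIdx j)]
  · simp [X, mono_unitIdx]
  · intro a ha
    simp [X, ha]

omit hx in
lemma ev_smul (c : ℂ) (f : WAlg d) : ev x (c • f) = c * ev x f := by
  rw [ev, ev, ← tsum_mul_left]
  refine tsum_congr fun a => ?_
  rw [coeff_smul, mul_smul_comm]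

lemma ev_mapCoeff (L : ℂ →L[ℝ] ℂ) (hL : ∀ z, ‖L z‖ ≤ ‖z‖) (f : WAlg d) :
    ev x (mapCoeff L hL f) = L (ev x f) := by
  rw [ev, ev, L.map_tsum (summable_norm_term hx f).of_norm]
  simp only [coeff_mapCoeff, map_smul]

end

/-- Evaluation at a point of the polydisc of radius `1 / 2`, as a homomorphism of algebras. -/
def evHom {x : Option (Fin d) → ℝ} (hx : ∀ j, |x j| ≤ 1 / 2) : WAlg d →ₐ[ℂ] ℂ :=
  AlgHom.ofLinearMap
    { toFun := ev x
      map_add' := ev_add hx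
      map_smul' := ev_smul } ev_one (ev_mul hx)

lemma evHom_apply {x : Option (Fin d) → ℝ} (hx : ∀ j, |x j| ≤ 1 / 2) (f : WAlg d) :
    evHom hx f = ev x f := rfl

lemma ev_J_of_eq_zero {x : Option (Fin d) → ℝ} (h0 : x none = 0) (f : WAlg d) :
    ev x (J f) = 0 := by
  rw [ev, ← tsum_zero (β := MIdx d)]
  refine tsum_congr fun a => ?_
  by_cases ha : a none = 0
  · rw [coeff_J, intCoeff_of_eq_zero _ ha, smul_zero]
  · rw [mono, Finset.prod_eq_zero (Finset.mem_univ none) (by rw [h0, zero_pow ha]), zero_smul]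

end WAlg

/-! ### Analyticity and derivatives of the sum of a power series -/

/-- The multi-index counting the occurrences of each variable in a word. -/
def wordIdx {n : ℕ} (i : Fin n → Option (Fin d)) : MIdx d := ∑ j, unitIdx (i j)

lemma exists_wordIdx_eq (n : ℕ) : ∀ a : MIdx d, a.degree = n →
    ∃ i : Fin n → Option (Fin d), wordIdx i = a := by
  induction n with
  | zero =>
    intro a ha
    exact ⟨Fin.elim0, by simpa [wordIdx] using ((Finsupp.degree_eq_zero_iff a).1 ha).symm⟩
  | succ n ih =>
    intro a ha
    have h0 : ∃ j, a j ≠ 0 := by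
      by_contra! h
      rw [(Finsupp.ext h : a = 0), map_zero] at ha
      omega
    obtain ⟨j, hj⟩ := h0
    obtain ⟨b, rfl⟩ := exists_add_unitIdx hj
    obtain ⟨i, rfl⟩ := ih b (by simpa using ha)
    exact ⟨Fin.cons j i, by simp [wordIdx, Fin.sum_univ_succ, add_comm]⟩

/-- A chosen word in the variables that represents a multi-index. -/
def word (a : MIdx d) : Fin a.degree → Option (Fin d) :=
  (exists_wordIdx_eq a.degree a rfl).choose

lemma wordIdx_word (a : MIdx d) : wordIdx (word a) = a :=
  (exists_wordIdx_eq a.degree a rfl).choose_spec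

/-- The chosen word together with its length. -/
def sigmaWord (a : MIdx d) : Σ n, Fin n → Option (Fin d) := ⟨a.degree, word a⟩

lemma sigmaWord_injective : Function.Injective (sigmaWord (d := d)) := fun a b h => by
  have := congrArg (fun w : Σ n, Fin n → Option (Fin d) => wordIdx w.2) h
  simpa [sigmaWord, wordIdx_word] using this

open Classical in
/-- The coefficient of a word: that of the monomial if the word is the chosen one, and zero
otherwise, so that every monomial is counted once. -/
def wordCoeff (f : WAlg d) (w : Σ n, Fin n → Option (Fin d)) : ℂ :=
  if w ∈ range sigmaWord then f.coeff (wordIdx w.2) else 0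

lemma wordCoeff_sigmaWord (f : WAlg d) (a : MIdx d) : wordCoeff f (sigmaWord a) = f.coeff a := by
  rw [wordCoeff, if_pos (mem_range_self a)]
  exact congrArg f.coeff (wordIdx_word a)

lemma wordCoeff_eq_zero (f : WAlg d) {w : Σ n, Fin n → Option (Fin d)}
    (hw : w ∉ range sigmaWord) : wordCoeff f w = 0 := if_neg hw

/-- The power series `f` as a formal multilinear series in the variables. -/
def WAlg.series (f : WAlg d) : FormalMultilinearSeries ℝ (Option (Fin d) → ℝ) ℂ := fun n =>
  ∑ i : Fin n → Option (Fin d),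
    ((ContinuousMultilinearMap.mkPiAlgebraFin ℝ n ℝ).compContinuousLinearMap
      fun j => ContinuousLinearMap.proj (i j)).smulRight (wordCoeff f ⟨n, i⟩)

namespace WAlg

lemma series_apply (f : WAlg d) (n : ℕ) (x : Option (Fin d) → ℝ) :
    f.series n (fun _ => x) =
      ∑ i : Fin n → Option (Fin d), mono x (wordIdx i) • wordCoeff f ⟨n, i⟩ := by
  rw [series, _root_.sum_apply]
  refine Finset.sum_congr rfl fun i _ => ?_
  have : ∀ s : Finset (Fin n), mono x (∑ j ∈ s, unitIdx (i j)) = ∏ j ∈ s, x (i j) := by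
    intro s
    induction s using Finset.induction_on with
    | empty => simp [mono_zero]
    | insert a s ha ih => rw [Finset.sum_insert ha, Finset.prod_insert ha, mono_add,
        mono_unitIdx, ih]
  simp [wordIdx, this, List.prod_ofFn]

lemma norm_series_le (f : WAlg d) (n : ℕ) :
    ‖f.series n‖ ≤ ∑ i : Fin n → Option (Fin d), ‖wordCoeff f ⟨n, i⟩‖ := by
  refine (norm_sum_le _ _).trans (Finset.sum_le_sum fun i _ => ?_)
  rw [ContinuousMultilinearMap.norm_smulRight]
  refine mul_le_of_le_one_left (norm_nonneg _) ?_
  refine (ContinuousMultilinearMap.norm_compContinuousLinearMap_le _ _).trans ?_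
  rw [ContinuousMultilinearMap.norm_mkPiAlgebraFin, one_mul]
  refine Finset.prod_le_one (fun _ _ => norm_nonneg _) fun j _ => ?_
  refine ContinuousLinearMap.opNorm_le_bound _ zero_le_one fun x => ?_
  rw [one_mul]
  exact norm_le_pi_norm x _

lemma half_le_radius_series (f : WAlg d) : ((1 / 2 : NNReal) : ENNReal) ≤ f.series.radius := by
  refine FormalMultilinearSeries.le_radius_of_summable _ ?_
  have hs : Summable fun w : Σ n, Fin n → Option (Fin d) =>
      ‖wordCoeff f w‖ * (1 / 2 : ℝ) ^ w.1 := by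
    refine (sigmaWord_injective.summable_iff fun w hw => ?_).1 ?_
    · rw [wordCoeff_eq_zero f hw, norm_zero, zero_mul]
    · refine f.summable_coeff.of_nonneg_of_le
        (fun a => mul_nonneg (norm_nonneg _) (by positivity)) fun a => ?_
      rw [Function.comp_apply, wordCoeff_sigmaWord, mul_comm]
      exact mul_le_mul_of_nonneg_right (half_pow_degree_le_wt a) (norm_nonneg _)
  refine hs.sigma.of_nonneg_of_le (fun n => by positivity) fun n => ?_
  rw [tsum_fintype]
  calc _ ≤ (∑ i : Fin n → Option (Fin d), ‖wordCoeff f ⟨n, i⟩‖) * (1 / 2 : ℝ) ^ n :=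
        mul_le_mul_of_nonneg_right (norm_series_le f n) (by positivity)
    _ = _ := Finset.sum_mul _ _ _

lemma hasFPowerSeriesOnBall_ev (f : WAlg d) :
    HasFPowerSeriesOnBall (fun x => ev x f) f.series 0 ((1 / 2 : NNReal) : ENNReal) where
  r_le := half_le_radius_series f
  r_pos := by simp
  hasSum := by
    intro x hx
    have hx' : ∀ j, |x j| ≤ 1 / 2 := fun j => by
      rw [Metric.eball_coe, mem_ball_zero_iff] at hx
      exact (norm_le_pi_norm x j).trans (by simpa using hx.le)
    simp only [series_apply, zero_add]
    have h : HasSum (fun w : Σ n, Fin n → Option (Fin d) =>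
        mono x (wordIdx w.2) • wordCoeff f w) (ev x f) := by
      refine (sigmaWord_injective.hasSum_iff fun w hw => ?_).1 ?_
      · rw [wordCoeff_eq_zero f hw, smul_zero]
      · have h1 := (summable_norm_term hx' f).of_norm.hasSum
        refine h1.congr_fun fun a => ?_
        rw [Function.comp_apply, wordCoeff_sigmaWord]
        exact congrArg (fun b => mono x b • f.coeff a) (wordIdx_word a)
    exact h.sigma fun n => hasSum_fintype _

lemma analyticAt_ev (f : WAlg d) {x : Option (Fin d) → ℝ} (hx : ‖x‖ < 1 / 2) :
    AnalyticAt ℝ (fun x => ev x f) x := by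
  refine f.hasFPowerSeriesOnBall_ev.analyticAt_of_mem ?_
  rw [Metric.eball_coe, mem_ball_zero_iff]
  simpa using hx

lemma mono_update (x : Option (Fin d) → ℝ) (j : Option (Fin d)) (u : ℝ) (a : MIdx d) :
    mono (Function.update x j u) a = u ^ a j * ∏ i ∈ Finset.univ.erase j, x i ^ a i := by
  rw [mono, ← Finset.mul_prod_erase _ _ (Finset.mem_univ j), Function.update_self]
  congr 1
  refine Finset.prod_congr rfl fun i hi => ?_
  rw [Function.update_of_ne (Finset.ne_of_mem_erase hi)]

/-- Termwise differentiation of a power series whose formal derivative is again in the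
weighted algebra. -/
lemma hasDerivAt_ev (j : Option (Fin d)) {f h : WAlg d} (hfh : h.coeff = derivCoeff j f.coeff)
    {x : Option (Fin d) → ℝ} (hx : ‖x‖ < 1 / 2) :
    HasDerivAt (fun u => ev (Function.update x j u) f) (ev x h) (x j) := by
  have hxj : ∀ i, |x i| < 1 / 2 := fun i => (norm_le_pi_norm x i).trans_lt hx
  have hup : ∀ u ∈ Metric.ball (0 : ℝ) (1 / 2), ∀ i, |Function.update x j u i| ≤ 1 / 2 := by
    intro u hu i
    by_cases hij : i = j
    · subst hij
      rw [Function.update_self]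
      exact (mem_ball_zero_iff.1 hu).le
    · rw [Function.update_of_ne hij]
      exact (hxj i).le
  -- the derivative of a term, and its relation to the terms of the formal derivative
  let g' : MIdx d → ℝ → ℂ := fun a u =>
    ((a j * u ^ (a j - 1)) * ∏ i ∈ Finset.univ.erase j, x i ^ a i : ℝ) • f.coeff a
  have hg' : ∀ a u, g' (a + unitIdx j) u = mono (Function.update x j u) a • h.coeff a := by
    intro a u
    have hp : ∏ i ∈ Finset.univ.erase j, x i ^ (a + unitIdx j) i =
        ∏ i ∈ Finset.univ.erase j, x i ^ a i :=
      Finset.prod_congr rfl fun i hi => by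
        simp [(Finset.ne_of_mem_erase hi).symm]
    simp only [g', hp, hfh, derivCoeff, mono_update]
    simp
    ring
  have hg0 : ∀ u, ∀ a ∉ range fun a : MIdx d => a + unitIdx j, g' a u = 0 := by
    intro u a ha
    have : a j = 0 := by
      by_contra h0
      exact ha (exists_add_unitIdx h0)
    simp [g', this]
  let b : MIdx d → ℝ := fun a => (1 / 2) ^ (a.degree - 1) * (a j * ‖f.coeff a‖)
  have hb : Summable b := by
    refine ((add_unitIdx_injective j).summable_iff fun a ha => ?_).1 ?_
    · have : a j = 0 := by
        by_contra h0
        exact ha (exists_add_unitIdx h0)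
      simp [b, this]
    · refine h.summable_coeff.of_nonneg_of_le (fun a => mul_nonneg (by positivity)
        (mul_nonneg (Nat.cast_nonneg _) (norm_nonneg _))) fun a => ?_
      have hn : ‖(a j : ℂ) + 1‖ = (a j : ℝ) + 1 := by exact_mod_cast Complex.norm_natCast _
      rw [hfh, derivCoeff, norm_mul, hn]
      simp only [b, Function.comp_apply, map_add, Finsupp.degree_single, Nat.add_sub_cancel,
        Finsupp.add_apply, Finsupp.single_eq_same, Nat.cast_add, Nat.cast_one]
      exact mul_le_mul_of_nonneg_right (half_pow_degree_le_wt a) (by positivity)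
  have key := hasDerivAt_tsum_of_isPreconnected (𝕜 := ℝ) (u := b)
    (g := fun a u => mono (Function.update x j u) a • f.coeff a) (g' := g')
    (t := Metric.ball 0 (1 / 2)) (y₀ := x j) (y := x j) hb Metric.isOpen_ball
    (convex_ball _ _).isPreconnected ?_ ?_ (mem_ball_zero_iff.2 (hxj j)) ?_
    (mem_ball_zero_iff.2 (hxj j))
  · have h2 : ∑' a, g' a (x j) = ev x h := by
      rw [← (add_unitIdx_injective j).tsum_eq (f := fun a => g' a (x j))
        (fun a ha => by_contra fun h0 => ha (hg0 _ a h0)), ev]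
      refine tsum_congr fun a => ?_
      rw [hg', Function.update_eq_self]
    rw [h2] at key
    exact key
  · intro a u _
    simp only [mono_update, g']
    exact (((hasDerivAt_pow (a j) u).mul_const _).smul_const _)
  · intro a u hu
    by_cases ha : a ∈ range fun a : MIdx d => a + unitIdx j
    · obtain ⟨a, rfl⟩ := ha
      beta_reduce
      have hn : ‖(a j : ℂ) + 1‖ = (a j : ℝ) + 1 := by exact_mod_cast Complex.norm_natCast _
      rw [hg', hfh, derivCoeff, norm_smul, norm_mul, hn]
      simp only [b, map_add, Finsupp.degree_single, Nat.add_sub_cancel,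
        Finsupp.add_apply, Finsupp.single_eq_same, Nat.cast_add, Nat.cast_one]
      exact mul_le_mul_of_nonneg_right (abs_mono_le (hup u hu) a) (by positivity)
    · rw [hg0 u a ha, norm_zero]
      positivity
  · rw [Function.update_eq_self]
    exact (summable_norm_term (fun j => (hxj j).le) f).of_norm

end WAlg

/-! ### Substitution of algebra elements into an analytic function -/

section Substitution

variable {E : Type*} [NormedAddCommGroup E] [NormedSpace ℝ E] {κ : Type*} [Fintype κ]

/-- The series `∑ₙ ∑_{i : Fin n → κ} pₙ(b_{i 1}, …, b_{i n}) a_{i 1} ⋯ a_{i n}` obtained by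
substituting `∑_k a_k b_k` with coefficients `a_k` in the Banach algebra into a power series on
`E`, for a finite family of vectors `b`. -/
def substSeries (A : Type*) [NormedCommRing A] [NormedAlgebra ℂ A] (b : κ → E)
    (p : FormalMultilinearSeries ℝ E ℂ) :
    FormalMultilinearSeries ℝ (κ → A) A := fun n =>
  ∑ i : Fin n → κ, p n (fun j => b (i j)) •
    (ContinuousMultilinearMap.mkPiAlgebraFin ℝ n A).compContinuousLinearMap
      fun j => ContinuousLinearMap.proj (i j)

variable {A : Type*} [NormedCommRing A] [NormedAlgebra ℂ A]
  (b : κ → E) (p : FormalMultilinearSeries ℝ E ℂ)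

lemma norm_substSeries_le [NormOneClass A] (n : ℕ) :
    ‖substSeries A b p n‖ ≤ ‖p n‖ * (∑ k, ‖b k‖) ^ n := by
  rw [Finset.sum_pow', Fintype.piFinset_univ, Finset.mul_sum]
  refine (norm_sum_le _ _).trans (Finset.sum_le_sum fun i _ => ?_)
  rw [norm_smul]
  have h1 : ‖(ContinuousMultilinearMap.mkPiAlgebraFin ℝ n A).compContinuousLinearMap
      fun j => ContinuousLinearMap.proj (R := ℝ) (φ := fun _ : κ => A) (i j)‖ ≤ 1 := by
    refine (ContinuousMultilinearMap.norm_compContinuousLinearMap_le _ _).trans ?_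
    rw [ContinuousMultilinearMap.norm_mkPiAlgebraFin, one_mul]
    refine Finset.prod_le_one (fun _ _ => norm_nonneg _) fun j _ => ?_
    refine ContinuousLinearMap.opNorm_le_bound _ zero_le_one fun x => ?_
    rw [one_mul]
    exact norm_le_pi_norm x _
  exact (mul_le_of_le_one_right (norm_nonneg _) h1).trans ((p n).le_opNorm _)

lemma exists_substSeries_bound [NormOneClass A] {r : NNReal} (hr : 0 < r)
    (hrp : (r : ENNReal) < p.radius) :
    ∃ ρ : NNReal, 0 < ρ ∧ (ρ : ENNReal) ≤ (substSeries A b p).radius ∧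
      ρ * ∑ k, ‖b k‖ ≤ r := by
  set C : NNReal := ∑ k, ‖b k‖₊ with hC
  have hC' : ∑ k, ‖b k‖ = C := by simp [hC]
  have hle : r / (C + 1) * C ≤ r := by
    rw [div_mul_eq_mul_div]
    exact div_le_of_le_mul₀ (by positivity) (by positivity) (by gcongr; simp)
  refine ⟨r / (C + 1), by positivity, ?_, by rw [hC']; exact_mod_cast hle⟩
  refine FormalMultilinearSeries.le_radius_of_summable _ ?_
  refine (p.summable_norm_mul_pow hrp).of_nonneg_of_le (fun n => by positivity) fun n => ?_
  calc _ ≤ (‖p n‖ * (∑ k, ‖b k‖) ^ n) * ((r / (C + 1) : NNReal) : ℝ) ^ n :=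
        mul_le_mul_of_nonneg_right (norm_substSeries_le b p n) (by positivity)
    _ = ‖p n‖ * (((r / (C + 1) : NNReal) : ℝ) * C) ^ n := by rw [hC', mul_pow]; ring
    _ ≤ _ := by
      gcongr
      exact_mod_cast hle

/-- A homomorphism to `ℂ` that takes real values on the substituted elements turns a term of the
substituted series into the term of the original one. -/
lemma map_substSeries (χ : A →ₐ[ℂ] ℂ) (a : κ → A) (c : κ → ℝ) (hc : ∀ k, χ (a k) = c k) (n : ℕ) :
    χ (substSeries A b p n fun _ => a) = p n fun _ => ∑ k, c k • b k := by
  rw [ContinuousMultilinearMap.map_sum, substSeries, _root_.sum_apply, map_sum]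
  refine Finset.sum_congr rfl fun i _ => ?_
  rw [ContinuousMultilinearMap.map_smul_univ, _root_.smul_apply, map_smul]
  simp [List.prod_ofFn, map_prod, hc, mul_comm]

end Substitution

section Substitution

variable {E : Type*} [NormedAddCommGroup E] [NormedSpace ℝ E] {κ : Type*} [Fintype κ]
variable {A : Type*} [NormedCommRing A] [NormedAlgebra ℂ A] [NormOneClass A] [CompleteSpace A]

/-- An analytic function on `E` induces a locally Lipschitz substitution map on a Banach algebra
that is compatible with contractive characters. -/
lemma exists_substitution {G : E → ℂ} {e : E} (hG : AnalyticAt ℝ G e) (b : κ → E) :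
    ∃ (P : (κ → A) → A) (C : NNReal) (ρ : ℝ), 0 < ρ ∧
      LipschitzOnWith C P (Metric.closedBall 0 ρ) ∧
      ∀ a, ‖a‖ ≤ ρ → ∀ χ : A →ₐ[ℂ] ℂ, (∀ f, ‖χ f‖ ≤ ‖f‖) → ∀ c : κ → ℝ,
        (∀ k, χ (a k) = c k) → χ (P a) = G (e + ∑ k, c k • b k) := by
  obtain ⟨p, R, hp⟩ := hG
  obtain ⟨r, hr0, hrR⟩ := ENNReal.lt_iff_exists_nnreal_btwn.1 hp.r_pos
  have hr0' : 0 < r := by exact_mod_cast hr0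
  obtain ⟨ρ, hρ0, hρ, hρr⟩ := exists_substSeries_bound (A := A) b p hr0' (hrR.trans_le hp.r_le)
  have hq := (substSeries A b p).hasFPowerSeriesOnBall
    (lt_of_lt_of_le (by exact_mod_cast hρ0) hρ)
  have hC : ContDiffAt ℝ 1 (substSeries A b p).sum 0 := hq.analyticAt.contDiffAt
  obtain ⟨C, t, ht, hlip⟩ := hC.exists_lipschitzOnWith
  obtain ⟨ε, hε0, hε⟩ := Metric.nhds_basis_closedBall.mem_iff.1 ht
  refine ⟨_, C, min ε (ρ / 2), by positivity, hlip.mono fun a ha => hε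
    (Metric.closedBall_subset_closedBall (min_le_left _ _) ha), fun a ha χ hχ c hc => ?_⟩
  have ha' : ‖a‖ < ρ := by
    have := ha.trans (min_le_right _ _)
    have : (0 : ℝ) < ρ := hρ0
    linarith
  have hmem : a ∈ Metric.eball (0 : κ → A) (substSeries A b p).radius := by
    refine Metric.eball_subset_eball hρ ?_
    rw [Metric.eball_coe]
    exact mem_ball_zero_iff.2 ha'
  have h1 := hq.hasSum hmem
  rw [zero_add] at h1
  have hχc : Continuous χ :=
    AddMonoidHomClass.continuous_of_bound χ 1 fun f => by simpa using hχ f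
  have h2 : HasSum (fun n => χ (substSeries A b p n fun _ => a)) (χ ((substSeries A b p).sum a)) :=
    h1.map χ hχc
  simp only [map_substSeries b p χ a c hc] at h2
  refine h2.unique (hp.hasSum ?_)
  refine Metric.eball_subset_eball hrR.le ?_
  rw [Metric.eball_coe, mem_ball_zero_iff]
  have hck : ∀ k, ‖c k • b k‖ ≤ ‖a‖ * ‖b k‖ := fun k => by
    rw [norm_smul]
    refine mul_le_mul_of_nonneg_right ?_ (norm_nonneg _)
    rw [← Complex.norm_real, ← hc]
    exact (hχ _).trans (norm_le_pi_norm a k)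
  have h3 : ‖∑ k, c k • b k‖ ≤ ‖a‖ * ∑ k, ‖b k‖ := by
    rw [Finset.mul_sum]
    exact (norm_sum_le _ _).trans (Finset.sum_le_sum fun k _ => hck k)
  have h4 : 0 ≤ ∑ k, ‖b k‖ := Finset.sum_nonneg fun _ _ => norm_nonneg _
  rcases h4.eq_or_lt with h5 | h5
  · rw [← h5, mul_zero] at h3
    exact h3.trans_lt hr0'
  · exact h3.trans_lt ((mul_lt_mul_of_pos_right ha' h5).trans_le hρr)

end Substitution

/-- The fixed point argument in terms of the argument `z = z₀ + T v` of `P`, where `v = P z`: it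
is enough that `P` is Lipschitz on a ball and that `T` is small. -/
lemma exists_fixedPoint {A B : Type*} [NormedAddCommGroup A] [NormedSpace ℝ A]
    [NormedAddCommGroup B] [NormedSpace ℝ B] [CompleteSpace B] {P : B → A} {C : NNReal} {ρ : ℝ}
    (hρ : 0 < ρ) (hP : LipschitzOnWith C P (Metric.closedBall 0 ρ)) {z₀ : B} (hz₀ : ‖z₀‖ ≤ ρ / 2)
    (T : A →L[ℝ] B) (hT : ‖T‖ * (‖P 0‖ + C * ρ) ≤ ρ / 2) (hTC : ‖T‖ * C ≤ 1 / 2) :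
    ∃ z, ‖z‖ ≤ ρ ∧ z = z₀ + T (P z) := by
  have h0 : (0 : B) ∈ Metric.closedBall (0 : B) ρ := Metric.mem_closedBall_self hρ.le
  have hmaps : MapsTo (fun z => z₀ + T (P z)) (Metric.closedBall 0 ρ) (Metric.closedBall 0 ρ) := by
    intro z hz
    have h1 := hP.dist_le_mul z hz 0 h0
    rw [mem_closedBall_zero_iff] at hz ⊢
    rw [dist_eq_norm, dist_zero_right] at h1
    have h2 : ‖P z‖ ≤ ‖P 0‖ + C * ρ := by
      have : ‖P z‖ ≤ ‖P z - P 0‖ + ‖P 0‖ := by simpa using norm_add_le (P z - P 0) (P 0)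
      have : (C : ℝ) * ‖z‖ ≤ C * ρ := by gcongr
      linarith
    have h3 := (T.le_opNorm (P z)).trans (mul_le_mul_of_nonneg_left h2 (norm_nonneg T))
    linarith [norm_add_le z₀ (T (P z))]
  have hcon : ContractingWith (1 / 2 : NNReal) (hmaps.restrict _ _ _) := by
    refine ⟨by rw [← NNReal.coe_lt_coe]; norm_num, LipschitzWith.of_dist_le_mul fun z w => ?_⟩
    have h1 := hP.dist_le_mul z.1 z.2 w.1 w.2
    change dist (z₀ + T (P z)) (z₀ + T (P w)) ≤ _ * dist z.1 w.1
    rw [dist_add_left, dist_eq_norm, ← map_sub]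
    rw [dist_eq_norm] at h1
    calc _ ≤ ‖T‖ * (C * dist z.1 w.1) :=
          (T.le_opNorm _).trans (mul_le_mul_of_nonneg_left h1 (norm_nonneg T))
      _ = (‖T‖ * C) * dist z.1 w.1 := by ring
      _ ≤ _ := by
        refine mul_le_mul_of_nonneg_right ?_ dist_nonneg
        simpa using hTC
  obtain ⟨z, hz, hfix, -⟩ := hcon.exists_fixedPoint' Metric.isClosed_closedBall.isComplete hmaps
    h0 (edist_ne_top _ _)
  exact ⟨z, mem_closedBall_zero_iff.1 hz, hfix.symm⟩

/-! ### Power series in scaled variables -/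

section Operators

variable {V : Type*} [NormedAddCommGroup V] [NormedSpace ℂ V]

lemma clm_smul_pow (c : ℂ) (T : V →L[ℂ] V) (n : ℕ) : (c • T) ^ n = c ^ n • T ^ n :=
  smul_pow c T n

lemma clm_smul_mul_smul (a b : ℂ) (S T : V →L[ℂ] V) : (a • S) * (b • T) = (a * b) • (S * T) :=
  smul_mul_smul_comm a S b T

lemma clm_commute_smul_smul (a b : ℂ) {S T : V →L[ℂ] V} (h : Commute S T) :
    Commute (a • S) (b • T) := (h.smul_left a).smul_right b

end Operators

/-- The coordinates `(t - t₁) / s`, `(y_i - y₁_i) / r`. -/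
def scale (x₁ : Pt d) (s r : ℝ) (x : Pt d) : Option (Fin d) → ℝ
  | none => (x.1 - x₁.1) / s
  | some i => (x.2 i - x₁.2 i) / r

/-- The open set on which the scaled coordinates are less than `1 / 2`. -/
def scaleDom (x₁ : Pt d) (s r : ℝ) : Set (Pt d) := {x | ‖scale x₁ s r x‖ < 1 / 2}

/-- The sum of a power series in the scaled coordinates. -/
def evs (x₁ : Pt d) (s r : ℝ) (f : WAlg d) (x : Pt d) : ℂ := WAlg.ev (scale x₁ s r x) f

lemma analyticAt_scale (x₁ : Pt d) (s r : ℝ) (x : Pt d) : AnalyticAt ℝ (scale x₁ s r) x := by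
  refine AnalyticAt.pi fun j => ?_
  cases j with
  | none => exact (analyticAt_fst.sub analyticAt_const).div_const
  | some i =>
    refine AnalyticAt.div_const (AnalyticAt.sub ?_ analyticAt_const)
    exact ((ContinuousLinearMap.proj (R := ℝ) (φ := fun _ : Fin d => ℝ) i).comp
      (ContinuousLinearMap.snd ℝ ℝ (Fin d → ℝ))).analyticAt x

lemma isOpen_scaleDom (x₁ : Pt d) (s r : ℝ) : IsOpen (scaleDom x₁ s r) := by
  have : Continuous (scale x₁ s r) :=
    continuous_iff_continuousAt.2 fun x => (analyticAt_scale x₁ s r x).continuousAt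
  exact isOpen_lt this.norm continuous_const

lemma self_mem_scaleDom (x₁ : Pt d) (s r : ℝ) : x₁ ∈ scaleDom x₁ s r := by
  have : scale x₁ s r x₁ = 0 := by
    funext j
    cases j <;> simp [scale]
  simp [scaleDom, this]

lemma analyticAt_evs (x₁ : Pt d) (s r : ℝ) (f : WAlg d) {x : Pt d} (hx : x ∈ scaleDom x₁ s r) :
    AnalyticAt ℝ (evs x₁ s r f) x :=
  (f.analyticAt_ev hx).comp (analyticAt_scale x₁ s r x)

/-- Chain rule for a direction `v` that moves only the scaled coordinate `j`, at speed `c`. -/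
lemma dirDeriv_evs {x₁ : Pt d} {s r c : ℝ} {j : Option (Fin d)} {v : Pt d}
    (hv : ∀ x u, scale x₁ s r (x + u • v) =
      Function.update (scale x₁ s r x) j (scale x₁ s r x j + c * u))
    {f h : WAlg d} (hfh : h.coeff = derivCoeff j f.coeff) {x : Pt d}
    (hx : x ∈ scaleDom x₁ s r) : dirDeriv v (evs x₁ s r f) x = c * evs x₁ s r h x := by
  have h1 : HasLineDerivAt ℝ (evs x₁ s r f) (dirDeriv v (evs x₁ s r f) x) x v :=
    (analyticAt_evs x₁ s r f hx).differentiableAt.hasFDerivAt.hasLineDerivAt v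
  have h2 : HasDerivAt (fun u : ℝ => scale x₁ s r x j + c * u) c 0 := by
    simpa using ((hasDerivAt_id (0 : ℝ)).const_mul c).const_add (scale x₁ s r x j)
  have h3 := WAlg.hasDerivAt_ev j hfh hx
  have h4 : HasDerivAt (fun u : ℝ => evs x₁ s r f (x + u • v)) (c • evs x₁ s r h x) 0 := by
    simp only [evs, hv]
    refine HasDerivAt.scomp (g₁ := fun u => WAlg.ev (Function.update (scale x₁ s r x) j u) f)
      (h := fun u => scale x₁ s r x j + c * u) 0 ?_ h2
    simpa using h3
  rw [← Complex.real_smul]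
  exact h1.unique h4

lemma scale_add_t (x₁ : Pt d) (s r : ℝ) (x : Pt d) (u : ℝ) :
    scale x₁ s r (x + u • (1, 0)) =
      Function.update (scale x₁ s r x) none (scale x₁ s r x none + s⁻¹ * u) := by
  funext j
  cases j with
  | none => simp [scale]; ring
  | some i => simp [scale]

lemma scale_add_y (x₁ : Pt d) (s r : ℝ) (i : Fin d) (x : Pt d) (u : ℝ) :
    scale x₁ s r (x + u • (0, Pi.single i 1)) =
      Function.update (scale x₁ s r x) (some i) (scale x₁ s r x (some i) + r⁻¹ * u) := by
  funext j
  cases j with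
  | none => simp [scale]
  | some k =>
    by_cases hk : k = i
    · subst hk
      simp [scale]; ring
    · simp [scale, hk]

lemma evs_smul (x₁ : Pt d) (s r : ℝ) (c : ℂ) (f : WAlg d) (x : Pt d) :
    evs x₁ s r (c • f) x = c * evs x₁ s r f x := WAlg.ev_smul c f

/-- Integration in the unscaled variable `t`. -/
def scaledJ (d : ℕ) (s : ℝ) : WAlg d →L[ℂ] WAlg d := (s : ℂ) • WAlg.J

/-- The operator `∂_t⁻¹ ∂_{y_i}` in unscaled variables. -/
def scaledK (s r : ℝ) (i : Fin d) : WAlg d →L[ℂ] WAlg d := ((s / r : ℝ) : ℂ) • WAlg.K i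

lemma scaledJ_scaledK_comm (s r : ℝ) (i : Fin d) : Commute (scaledJ d s) (scaledK s r i) :=
  clm_commute_smul_smul _ _ (WAlg.J_K_comm i)

section

variable {x₁ : Pt d} {s r : ℝ}

lemma Dt_evs (hs : s ≠ 0) {F : Pt d → ℂ} {f : WAlg d}
    (hF : EqOn F (evs x₁ s r (scaledJ d s f)) (scaleDom x₁ s r)) :
    EqOn (Dt F) (evs x₁ s r f) (scaleDom x₁ s r) := by
  intro x hx
  have h1 : F =ᶠ[𝓝 x] evs x₁ s r (scaledJ d s f) :=
    hF.eventuallyEq_of_mem ((isOpen_scaleDom x₁ s r).mem_nhds hx)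
  have h2 : Dt F x = Dt (evs x₁ s r (scaledJ d s f)) x := by
    change fderiv ℝ F x (1, 0) = fderiv ℝ _ x (1, 0)
    rw [h1.fderiv_eq]
  have hfh : ((s : ℂ) • f).coeff = derivCoeff none (scaledJ d s f).coeff := by
    have : scaledJ d s f = WAlg.J ((s : ℂ) • f) := by simp [scaledJ]
    rw [this, WAlg.coeff_J, derivCoeff_intCoeff]
  rw [h2, Dt, dirDeriv_evs (scale_add_t x₁ s r) hfh hx, evs_smul, ← mul_assoc]
  have : (s : ℂ) ≠ 0 := by exact_mod_cast hs
  simp [this]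

lemma Dy_evs (i : Fin d) {F : Pt d → ℂ} {f : WAlg d}
    (hF : EqOn F (evs x₁ s r (scaledJ d s f)) (scaleDom x₁ s r)) :
    EqOn (Dy i F) (evs x₁ s r (scaledK s r i f)) (scaleDom x₁ s r) := by
  intro x hx
  have h1 : F =ᶠ[𝓝 x] evs x₁ s r (scaledJ d s f) :=
    hF.eventuallyEq_of_mem ((isOpen_scaleDom x₁ s r).mem_nhds hx)
  have h2 : Dy i F x = Dy i (evs x₁ s r (scaledJ d s f)) x := by
    change fderiv ℝ F x _ = fderiv ℝ _ x _
    rw [h1.fderiv_eq]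
  have hfh : (WAlg.K i ((s : ℂ) • f)).coeff = derivCoeff (some i) (scaledJ d s f).coeff := by
    have : scaledJ d s f = WAlg.J ((s : ℂ) • f) := by simp [scaledJ]
    rw [this, WAlg.coeff_K]
  rw [h2, Dy, dirDeriv_evs (scale_add_y x₁ s r i) hfh hx, map_smul, evs_smul]
  simp only [scaledK, _root_.smul_apply, evs_smul]
  push_cast
  ring

lemma Dt_iterate_evs (hs : s ≠ 0) (j p : ℕ) : ∀ {F : Pt d → ℂ} {f : WAlg d},
    EqOn F (evs x₁ s r ((scaledJ d s ^ (j + p)) f)) (scaleDom x₁ s r) →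
    EqOn (Dt^[p] F) (evs x₁ s r ((scaledJ d s ^ j) f)) (scaleDom x₁ s r) := by
  induction p with
  | zero => intro F f hF; exact hF
  | succ p ih =>
    intro F f hF
    rw [Function.iterate_succ_apply]
    refine ih (Dt_evs hs ?_)
    rwa [← add_assoc, pow_succ'] at hF

lemma Dy_iterate_evs (i : Fin d) (j n : ℕ) : ∀ {F : Pt d → ℂ} {f : WAlg d},
    EqOn F (evs x₁ s r ((scaledJ d s ^ (j + n)) f)) (scaleDom x₁ s r) →
    EqOn ((Dy i)^[n] F) (evs x₁ s r ((scaledJ d s ^ j) ((scaledK s r i ^ n) f)))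
      (scaleDom x₁ s r) := by
  induction n with
  | zero => intro F f hF; exact hF
  | succ n ih =>
    intro F f hF
    rw [Function.iterate_succ_apply, pow_succ]
    refine ih (f := scaledK s r i f) ?_
    have hc := ((scaledJ_scaledK_comm s r i).pow_left (j + n)).eq
    have h2 : (scaledJ d s ^ (j + n)) (scaledK s r i f) =
        scaledK s r i ((scaledJ d s ^ (j + n)) f) := DFunLike.congr_fun hc f
    rw [h2]
    refine Dy_evs i ?_
    rwa [← add_assoc, pow_succ'] at hF

/-- The product of the operators `(∂_t⁻¹ ∂_{y_i})^{q_i}` along a list of indices. -/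
def prodK (s r : ℝ) (q : Fin d → ℕ) (l : List (Fin d)) : WAlg d →L[ℂ] WAlg d :=
  (l.map fun i => scaledK s r i ^ q i).prod

/-- Each `y`-derivative uses up one of the available `t`-primitives, so that all intermediate
functions are again sums of elements of the weighted algebra. -/
lemma foldr_Dy_evs (q : Fin d → ℕ) (l : List (Fin d)) (f : WAlg d) : ∀ j : ℕ,
    EqOn (l.foldr (fun i g => (Dy i)^[q i] g)
        (evs x₁ s r ((scaledJ d s ^ (j + (l.map q).sum)) f)))
      (evs x₁ s r ((scaledJ d s ^ j) (prodK s r q l f))) (scaleDom x₁ s r) := by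
  induction l with
  | nil => intro j x _; simp [prodK]
  | cons a l ih =>
    intro j
    have h := ih (j + q a)
    rw [add_assoc, ← List.sum_cons, ← List.map_cons] at h
    rw [List.foldr_cons]
    have h2 := Dy_iterate_evs a j (q a) h
    have e : prodK s r q (a :: l) f = (scaledK s r a ^ q a) (prodK s r q l f) := by simp [prodK]
    rw [e]
    exact h2

/-- The operator `∂_t^{-j} ∂_y^q`, `|q| ≤ j`, written with `k = j - |q|`. -/
def jetOp (s r : ℝ) (k : ℕ) (q : Fin d → ℕ) : WAlg d →L[ℂ] WAlg d :=
  scaledJ d s ^ k * prodK s r q (List.finRange d)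

/-- The derivatives of order at most `m` of an `m`-fold primitive in `t`. -/
lemma partialD_evs (hs : s ≠ 0) {k m p : ℕ} {q : Fin d → ℕ} (h : k + p + ∑ i, q i = m)
    (f : WAlg d) :
    EqOn (partialD p q (evs x₁ s r ((scaledJ d s ^ m) f))) (evs x₁ s r (jetOp s r k q f))
      (scaleDom x₁ s r) := by
  have hq : ((List.finRange d).map q).sum = ∑ i, q i := (Fin.sum_univ_def q).symm
  have h1 := foldr_Dy_evs (x₁ := x₁) (s := s) (r := r) q (List.finRange d) f (k + p)
  rw [hq, h] at h1
  exact Dt_iterate_evs hs k p h1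

lemma prodK_eq_smul (s r : ℝ) (q : Fin d → ℕ) (l : List (Fin d)) :
    prodK s r q l = (s : ℂ) ^ (l.map q).sum • prodK 1 r q l := by
  induction l with
  | nil => simp [prodK]
  | cons a l ih =>
    have h : scaledK s r a = (s : ℂ) • scaledK 1 r a := by
      rw [scaledK, scaledK, smul_smul]
      push_cast
      congr 1
      ring
    have e : ∀ s, prodK s r q (a :: l) = scaledK s r a ^ q a * prodK s r q l := fun s => by
      simp [prodK]
    rw [e, e, ih, h, clm_smul_pow, clm_smul_mul_smul, List.map_cons, List.sum_cons, pow_add]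

lemma norm_jetOp_le (hs : 0 ≤ s) (hs1 : s ≤ 1) (r : ℝ) {k : ℕ} {q : Fin d → ℕ}
    (h : 0 < k + ∑ i, q i) : ‖jetOp s r k q‖ ≤ s * ‖jetOp 1 r k q‖ := by
  have hq : ((List.finRange d).map q).sum = ∑ i, q i := (Fin.sum_univ_def q).symm
  have e : jetOp s r k q = (s : ℂ) ^ (k + ∑ i, q i) • jetOp 1 r k q := by
    rw [jetOp, jetOp, prodK_eq_smul, hq]
    have : scaledJ d s = (s : ℂ) • scaledJ d 1 := by simp [scaledJ]
    rw [this, clm_smul_pow, clm_smul_mul_smul, pow_add]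
  rw [e, norm_smul, norm_pow, Complex.norm_real, Real.norm_of_nonneg hs]
  exact mul_le_mul_of_nonneg_right (pow_le_of_le_one hs hs1 h.ne') (norm_nonneg _)

end

/-! ### Local existence -/

lemma norm_ofReal_re_le (z : ℂ) : ‖(Complex.ofRealCLM.comp Complex.reCLM) z‖ ≤ ‖z‖ := by
  simpa using Complex.abs_re_le_norm z

lemma norm_ofReal_im_le (z : ℂ) : ‖(Complex.ofRealCLM.comp Complex.imCLM) z‖ ≤ ‖z‖ := by
  simpa using Complex.abs_im_le_norm z

/-- Coefficientwise real part. -/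
def WAlg.re : WAlg d →L[ℝ] WAlg d :=
  WAlg.mapCoeff (Complex.ofRealCLM.comp Complex.reCLM) norm_ofReal_re_le

/-- Coefficientwise imaginary part. -/
def WAlg.im : WAlg d →L[ℝ] WAlg d :=
  WAlg.mapCoeff (Complex.ofRealCLM.comp Complex.imCLM) norm_ofReal_im_le

lemma WAlg.norm_mapCoeff_le (L : ℂ →L[ℝ] ℂ) (hL : ∀ z, ‖L z‖ ≤ ‖z‖) (f : WAlg d) :
    ‖WAlg.mapCoeff L hL f‖ ≤ ‖f‖ :=
  (WAlg.mapCoeff L hL f).summable_coeff.tsum_le_tsum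
    (fun a => mul_le_mul_of_nonneg_left (hL _) (wt_pos a).le) f.summable_coeff

/-- Real coordinates on the space of the points `(t, y, (z_a))`. -/
abbrev JetCoord (d m : ℕ) : Type := Option (Fin d) ⊕ (JetIndex d m ⊕ JetIndex d m)

/-- The real basis vectors belonging to the coordinates `t`, `y_i`, `Re z_a`, `Im z_a`. -/
def jetBasis : JetCoord d m → Pt d × (JetIndex d m → ℂ)
  | .inl none => ((1, 0), 0)
  | .inl (some i) => ((0, Pi.single i 1), 0)
  | .inr (.inl a) => (0, Pi.single a 1)
  | .inr (.inr a) => (0, Pi.single a Complex.I)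

lemma sum_jetBasis (c : JetCoord d m → ℝ) :
    ∑ k, c k • jetBasis k = ((c (.inl none), fun i => c (.inl (some i))),
      fun a => ((c (.inr (.inl a)) : ℂ) + c (.inr (.inr a)) * Complex.I)) := by
  rw [Fintype.sum_sum_type, Fintype.sum_sum_type, Fintype.sum_option]
  refine Prod.ext (Prod.ext ?_ (funext fun i => ?_)) (funext fun a => ?_)
  · simp [jetBasis, Prod.fst_sum]
  · simp [jetBasis, Prod.fst_sum, Prod.snd_sum, Pi.single_apply]
  · simp [jetBasis, Prod.snd_sum, Pi.single_apply]

/-- The order of the primitive left after the `y`-derivatives of a jet component. -/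
def jetRest (a : JetIndex d m) : ℕ := m - a.1.1 - ∑ i, (a.1.2 i : ℕ)

lemma jetRest_add (a : JetIndex d m) :
    jetRest a + (a.1.1 : ℕ) + ∑ i, (a.1.2 i : ℕ) = m := by
  have := a.2
  rw [jetRest]; omega

lemma jetRest_pos (a : JetIndex d m) : 0 < jetRest a + ∑ i, (a.1.2 i : ℕ) := by
  have := jetRest_add a
  have := a.1.1.2
  omega

/-- The jet component `D_t^p D_y^q` of the `m`-fold primitive, as an operator on power series. -/
def jetCompOp (s r : ℝ) (a : JetIndex d m) : WAlg d →L[ℂ] WAlg d :=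
  jetOp s r (jetRest a) fun i => (a.1.2 i : ℕ)

/-- The part of the argument of `G` that depends on the unknown: real and imaginary parts of the
jet components. -/
def jetSubst (m : ℕ) (s r : ℝ) : WAlg d →L[ℝ] (JetCoord d m → WAlg d) :=
  ContinuousLinearMap.pi fun
    | .inl _ => 0
    | .inr (.inl a) => WAlg.re.comp ((jetCompOp s r a).restrictScalars ℝ)
    | .inr (.inr a) => WAlg.im.comp ((jetCompOp s r a).restrictScalars ℝ)

lemma norm_jetSubst_le {s : ℝ} (hs : 0 ≤ s) (hs1 : s ≤ 1) (r : ℝ) :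
    ‖(jetSubst m s r : WAlg d →L[ℝ] _)‖ ≤ s * ∑ a : JetIndex d m, ‖jetCompOp (d := d) 1 r a‖ := by
  have h0 : 0 ≤ s * ∑ a : JetIndex d m, ‖jetCompOp (d := d) 1 r a‖ :=
    mul_nonneg hs (Finset.sum_nonneg fun _ _ => norm_nonneg _)
  have h1 : ∀ (a : JetIndex d m) (f : WAlg d), ‖jetCompOp s r a f‖ ≤
      s * (∑ a : JetIndex d m, ‖jetCompOp (d := d) 1 r a‖) * ‖f‖ := fun a f => by
    refine ((jetCompOp s r a).le_opNorm f).trans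
      (mul_le_mul_of_nonneg_right ?_ (norm_nonneg _))
    refine (norm_jetOp_le hs hs1 r (jetRest_pos a)).trans (mul_le_mul_of_nonneg_left ?_ hs)
    exact Finset.single_le_sum (f := fun a : JetIndex d m => ‖jetCompOp (d := d) 1 r a‖)
      (fun _ _ => norm_nonneg _) (Finset.mem_univ a)
  refine ContinuousLinearMap.opNorm_le_bound _ h0 fun f => ?_
  refine (pi_norm_le_iff_of_nonneg (mul_nonneg h0 (norm_nonneg _))).2 ?_
  rintro (_ | a | a)
  · change ‖(0 : WAlg d)‖ ≤ _
    rw [norm_zero]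
    exact mul_nonneg h0 (norm_nonneg _)
  · exact (WAlg.norm_mapCoeff_le _ norm_ofReal_re_le _).trans (h1 a f)
  · exact (WAlg.norm_mapCoeff_le _ norm_ofReal_im_le _).trans (h1 a f)

/-- The part of the argument of `G` that stands for the independent variables. -/
def baseSubst (d m : ℕ) (s r : ℝ) : JetCoord d m → WAlg d
  | .inl none => (s : ℂ) • WAlg.X none
  | .inl (some i) => (r : ℂ) • WAlg.X (some i)
  | .inr _ => 0

lemma norm_X (j : Option (Fin d)) : ‖(WAlg.X j : WAlg d)‖ ≤ 1 := by
  rw [WAlg.norm_def, tsum_eq_single (unitIdx j)]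
  · cases j <;> simp [WAlg.X, wt]
  · intro a ha
    simp [WAlg.X, ha]

lemma norm_baseSubst_le {s r : ℝ} (hs : 0 ≤ s) (hsr : s ≤ r) : ‖baseSubst d m s r‖ ≤ r := by
  have hr := hs.trans hsr
  refine (pi_norm_le_iff_of_nonneg hr).2 ?_
  rintro ((_ | i) | _)
  · simp only [baseSubst, norm_smul, Complex.norm_real, Real.norm_of_nonneg hs]
    exact (mul_le_of_le_one_right hs (norm_X _)).trans hsr
  · simp only [baseSubst, norm_smul, Complex.norm_real, Real.norm_of_nonneg hr]
    exact mul_le_of_le_one_right hr (norm_X _)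
  · simpa [baseSubst] using hr

/-- Local solvability with vanishing initial data. The unknown `v = D_t^m U` is the fixed point of
a contraction of the Banach algebra of power series. -/
lemma exists_local_solution_zero {F : Pt d × (JetIndex d m → ℂ) → ℂ} {x₁ : Pt d}
    (hF : AnalyticAt ℝ F (x₁, 0)) :
    ∃ Ω : Set (Pt d), IsOpen Ω ∧ x₁ ∈ Ω ∧ ∃ U : Pt d → ℂ, AnalyticOnNhd ℝ U Ω ∧
      (∀ x ∈ Ω, partialD m 0 U x = F (jet m U x)) ∧
      ∀ p < m, ∀ x ∈ Ω, x.1 = x₁.1 → partialD p 0 U x = 0 := by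
  obtain ⟨P, C, ρ, hρ, hlip, hP⟩ := exists_substitution (A := WAlg d) hF
    (jetBasis (d := d) (m := m))
  -- `r` is fixed first; then `s` is taken small enough for the contraction
  set r : ℝ := ρ / 2 with hr
  have hr0 : 0 < r := by positivity
  set B : ℝ := ∑ a : JetIndex d m, ‖jetCompOp (d := d) 1 r a‖ with hB
  have hB0 : 0 ≤ B := Finset.sum_nonneg fun _ _ => norm_nonneg _
  set M : ℝ := ‖P 0‖ + C * ρ with hM
  have hM0 : 0 ≤ M := by positivity
  obtain ⟨s, hs0, hs1, hsr, hsM, hsC⟩ : ∃ s : ℝ, 0 < s ∧ s ≤ 1 ∧ s ≤ r ∧ s * B * M ≤ ρ / 2 ∧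
      s * B * C ≤ 1 / 2 := by
    have hc : ∀ D : ℝ, ∀ ε > 0, ∀ᶠ s in 𝓝[>] (0 : ℝ), s * B * D ≤ ε := fun D ε hε => by
      have : Tendsto (fun s : ℝ => s * B * D) (𝓝 0) (𝓝 (0 * B * D)) :=
        ((continuous_id.mul continuous_const).mul continuous_const).tendsto 0
      rw [zero_mul, zero_mul] at this
      exact (this.mono_left nhdsWithin_le_nhds).eventually_le_const hε
    have hi : ∀ ε > 0, ∀ᶠ s in 𝓝[>] (0 : ℝ), s ≤ ε := fun ε hε =>
      nhdsWithin_le_nhds (eventually_le_nhds hε)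
    obtain ⟨s, h⟩ := ((eventually_mem_nhdsWithin (a := (0 : ℝ)) (s := Ioi 0)).and
      ((hi 1 one_pos).and ((hi r hr0).and ((hc M (ρ / 2) (by positivity)).and
        (hc C (1 / 2) (by norm_num)))))).exists
    exact ⟨s, h.1, h.2.1, h.2.2.1, h.2.2.2.1, h.2.2.2.2⟩
  have hT := norm_jetSubst_le (d := d) (m := m) hs0.le hs1 r
  obtain ⟨z, hz, hzfix⟩ := exists_fixedPoint hρ hlip
    ((norm_baseSubst_le (d := d) (m := m) hs0.le hsr).trans_eq hr) (jetSubst m s r)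
    ((mul_le_mul_of_nonneg_right hT hM0).trans hsM)
    ((mul_le_mul_of_nonneg_right hT C.2).trans hsC)
  set v : WAlg d := P z with hv
  have hjet : ∀ (p : ℕ) (q : Fin d → ℕ) (k : ℕ), k + p + ∑ i, q i = m →
      EqOn (partialD p q (evs x₁ s r ((scaledJ d s ^ m) v))) (evs x₁ s r (jetOp s r k q v))
        (scaleDom x₁ s r) := fun p q k h => partialD_evs hs0.ne' h v
  refine ⟨scaleDom x₁ s r, isOpen_scaleDom _ _ _, self_mem_scaleDom _ _ _,
    evs x₁ s r ((scaledJ d s ^ m) v), fun x hx => analyticAt_evs _ _ _ _ hx, fun x hx => ?_,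
    fun p hp x hx hx1 => ?_⟩
  · have h1 := hjet m 0 0 (by simp) hx
    have hprod : jetOp s r 0 (0 : Fin d → ℕ) v = v := by simp [jetOp, prodK]
    rw [h1, hprod]
    have hxx : ∀ j, |scale x₁ s r x j| ≤ 1 / 2 := fun j =>
      (norm_le_pi_norm (scale x₁ s r x) j).trans (le_of_lt hx)
    let c : JetCoord d m → ℝ := fun
      | .inl none => x.1 - x₁.1
      | .inl (some i) => x.2 i - x₁.2 i
      | .inr (.inl a) => (evs x₁ s r (jetCompOp s r a v) x).re
      | .inr (.inr a) => (evs x₁ s r (jetCompOp s r a v) x).im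
    have hc : ∀ k, WAlg.evHom hxx (z k) = c k := by
      intro k
      rw [hzfix]
      rcases k with (_ | i) | a | a
      · change WAlg.evHom hxx ((s : ℂ) • WAlg.X none + 0) = _
        have hs' : s ≠ 0 := hs0.ne'
        rw [add_zero, map_smul, WAlg.evHom_apply, WAlg.ev_X, smul_eq_mul, ← Complex.ofReal_mul]
        congr 1
        simp only [scale, c]
        field_simp
      · change WAlg.evHom hxx ((r : ℂ) • WAlg.X (some i) + 0) = _
        have hr' : r ≠ 0 := hr0.ne'
        rw [add_zero, map_smul, WAlg.evHom_apply, WAlg.ev_X, smul_eq_mul, ← Complex.ofReal_mul]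
        congr 1
        simp only [scale, c]
        field_simp
      · change WAlg.evHom hxx (0 + WAlg.re (jetCompOp s r a v)) = _
        rw [zero_add, WAlg.evHom_apply]
        exact WAlg.ev_mapCoeff hxx _ _ _
      · change WAlg.evHom hxx (0 + WAlg.im (jetCompOp s r a v)) = _
        rw [zero_add, WAlg.evHom_apply]
        exact WAlg.ev_mapCoeff hxx _ _ _
    have h2 := hP z hz (WAlg.evHom hxx) (WAlg.norm_ev_le hxx) c hc
    rw [sum_jetBasis] at h2
    refine h2.trans (congrArg F ?_)
    refine Prod.ext (Prod.ext ?_ (funext fun i => ?_)) (funext fun a => ?_)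
    · simp [c, jet]
    · simp [c, jet]
    · have h3 := hjet (a.1.1 : ℕ) (fun i => (a.1.2 i : ℕ)) (jetRest a) (jetRest_add a) hx
      simp only [jet, h3, c, Prod.snd_add, Pi.add_apply, Pi.zero_apply, zero_add]
      exact Complex.re_add_im _
  · rw [hjet p 0 (m - p) (by simp; omega) hx]
    have h0 : scale x₁ s r x none = 0 := by simp [scale, hx1]
    obtain ⟨k, hk⟩ := Nat.exists_eq_succ_of_ne_zero (Nat.sub_ne_zero_of_lt hp)
    have : jetOp s r (m - p) (0 : Fin d → ℕ) v = (s : ℂ) • WAlg.J ((scaledJ d s ^ k) v) := by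
      rw [hk, jetOp, pow_succ']
      simp [prodK, scaledJ]
    rw [this, evs_smul, evs, WAlg.ev_J_of_eq_zero h0, mul_zero]

/-! ### Partial derivatives of analytic functions -/

lemma listD_analyticAt {f : Pt d → ℂ} {x : Pt d} (hf : AnalyticAt ℝ f x) (l : List (Pt d)) :
    AnalyticAt ℝ (listD l f) x := by
  induction l with
  | nil => exact hf
  | cons v l ih =>
    exact ((ContinuousLinearMap.apply ℝ ℂ v).analyticAt _).comp ih.fderiv

lemma partialD_analyticAt {f : Pt d → ℂ} {x : Pt d} (hf : AnalyticAt ℝ f x) (p : ℕ)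
    (q : Fin d → ℕ) : AnalyticAt ℝ (partialD p q f) x := by
  rw [partialD_eq_listD]
  exact listD_analyticAt hf _

lemma eventually_contDiffAt {f : Pt d → ℂ} {x : Pt d} (hf : AnalyticAt ℝ f x) :
    ∀ᶠ y in 𝓝 x, ContDiffAt ℝ ∞ f y :=
  hf.eventually_analyticAt.mono fun _ hy => hy.contDiffAt

lemma partialD_sub {f g : Pt d → ℂ} {x : Pt d} (hf : AnalyticAt ℝ f x) (hg : AnalyticAt ℝ g x)
    (p : ℕ) (q : Fin d → ℕ) : partialD p q (f - g) x = partialD p q f x - partialD p q g x := by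
  rw [partialD_eq_listD, partialD_eq_listD, partialD_eq_listD,
    listD_sub _ (eventually_contDiffAt hf) (eventually_contDiffAt hg)]

lemma partialD_congr {f g : Pt d → ℂ} {x : Pt d} (h : f =ᶠ[𝓝 x] g) (p : ℕ) (q : Fin d → ℕ) :
    partialD p q f x = partialD p q g x := by
  rw [partialD_eq_listD, partialD_eq_listD]
  exact (listD_congr h _).self_of_nhds

lemma partialD_zero_right (p : ℕ) (f : Pt d → ℂ) : partialD p 0 f = Dt^[p] f := by
  rw [partialD]
  congr 1
  induction List.finRange d with
  | nil => rfl
  | cons a l ih => rw [List.foldr_cons, ih]; rfl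

lemma analyticAt_slice {f : Pt d → ℂ} {t : ℝ} {y : Fin d → ℝ} (hf : AnalyticAt ℝ f (t, y)) :
    AnalyticAt ℝ (fun u => f (u, y)) t :=
  AnalyticAt.comp (f := fun u : ℝ => ((u, y) : Pt d)) hf (analyticAt_id.prod analyticAt_const)

lemma Dt_eq_deriv {f : Pt d → ℂ} {t : ℝ} {y : Fin d → ℝ} (hf : AnalyticAt ℝ f (t, y)) :
    Dt f (t, y) = deriv (fun u => f (u, y)) t := by
  have h1 : HasDerivAt (fun u : ℝ => ((u, y) : Pt d)) (1, 0) t :=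
    (hasDerivAt_id t).prodMk (hasDerivAt_const t y)
  exact (HasFDerivAt.comp_hasDerivAt (f := fun u : ℝ => ((u, y) : Pt d)) t
    hf.differentiableAt.hasFDerivAt h1).deriv.symm

lemma Dt_iterate_analyticAt {f : Pt d → ℂ} {x : Pt d} (hf : AnalyticAt ℝ f x) (p : ℕ) :
    AnalyticAt ℝ (Dt^[p] f) x := by
  rw [← partialD_zero_right]
  exact partialD_analyticAt hf p 0

/-- Along a line parallel to the `t`-axis, `D_t^p` is the ordinary derivative of order `p`. -/
lemma Dt_iterate_eq_iteratedDeriv (p : ℕ) : ∀ {f : Pt d → ℂ} {t : ℝ} {y : Fin d → ℝ},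
    AnalyticAt ℝ f (t, y) → Dt^[p] f (t, y) = iteratedDeriv p (fun u => f (u, y)) t := by
  induction p with
  | zero => intros; simp
  | succ p ih =>
    intro f t y hf
    rw [Function.iterate_succ_apply', Dt_eq_deriv (Dt_iterate_analyticAt hf p), iteratedDeriv_succ]
    refine Filter.EventuallyEq.deriv_eq ?_
    have hc : Continuous fun u : ℝ => ((u, y) : Pt d) := by fun_prop
    filter_upwards [hc.continuousAt.eventually hf.eventually_analyticAt] with u hu
    exact ih hu

/-! ### Local solutions with prescribed data -/

/-- The negative of the Taylor polynomial in `t` with coefficients `g_p / p!`. -/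
def negTaylor (t₁ : ℝ) (g : Fin m → (Fin d → ℝ) → ℂ) (x : Pt d) : ℂ :=
  -∑ j : Fin m, (x.1 - t₁) ^ (j : ℕ) • ((((j : ℕ).factorial : ℂ))⁻¹ * g j x.2)

lemma analyticAt_negTaylor {t₁ : ℝ} {g : Fin m → (Fin d → ℝ) → ℂ} {x : Pt d}
    (hg : ∀ p, AnalyticAt ℝ (g p) x.2) : AnalyticAt ℝ (negTaylor t₁ g) x := by
  refine AnalyticAt.neg (Finset.analyticAt_fun_sum _ fun j _ => ?_)
  refine AnalyticAt.smul ((analyticAt_fst.sub analyticAt_const).pow _) ?_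
  exact analyticAt_const.mul ((hg j).comp analyticAt_snd)

lemma partialD_negTaylor {t₁ : ℝ} {g : Fin m → (Fin d → ℝ) → ℂ} {y : Fin d → ℝ}
    (hg : ∀ p, AnalyticAt ℝ (g p) y) (p : Fin m) :
    partialD (p : ℕ) 0 (negTaylor t₁ g) (t₁, y) = -g p y := by
  rw [partialD_zero_right, Dt_iterate_eq_iteratedDeriv _ (analyticAt_negTaylor hg)]
  have hc : ∀ n k : ℕ, ContDiffAt ℝ k (fun u : ℝ => (u - t₁) ^ n) t₁ := fun n k => by fun_prop
  have h1 : ∀ j : Fin m, iteratedDeriv (p : ℕ) (fun u : ℝ =>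
      (u - t₁) ^ (j : ℕ) • ((((j : ℕ).factorial : ℂ))⁻¹ * g j y)) t₁ =
      if p = j then g j y else 0 := fun j => by
    rw [iteratedDeriv_smul_const (hc _ _),
      iteratedDeriv_comp_sub_const (p : ℕ) (fun u : ℝ => u ^ (j : ℕ)) t₁]
    simp only [sub_self, iteratedDeriv_fun_pow_zero, Fin.val_inj]
    split_ifs with h
    · subst h
      have : ((p : ℕ).factorial : ℂ) ≠ 0 := by exact_mod_cast Nat.factorial_ne_zero _
      rw [Complex.real_smul]
      push_cast
      field_simp
    · simp
  simp only [negTaylor]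
  have h2 : ∀ j : Fin m, ContDiffAt ℝ (p : ℕ) (fun u : ℝ =>
      (u - t₁) ^ (j : ℕ) • ((((j : ℕ).factorial : ℂ))⁻¹ * g j y)) t₁ := fun j =>
    (hc _ _).smul contDiffAt_const
  rw [iteratedDeriv_fun_neg, iteratedDeriv_fun_sum fun j _ => h2 j,
    Finset.sum_congr rfl fun j _ => h1 j, Finset.sum_ite_eq, if_pos (Finset.mem_univ p)]

/-- **Cauchy–Kovalevskaya**, local existence: near a point `x₁` of the domain there is an analytic
solution whose initial values on `t = t₁` are given analytic functions. -/
lemma exists_local_solution {X : Opens (Pt d)} {G : Pt d × (JetIndex d m → ℂ) → ℂ}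
    (hG : AnalyticOnNhd ℝ G ((X : Set (Pt d)) ×ˢ univ)) {x₁ : Pt d} (hx₁ : x₁ ∈ X)
    {g : Fin m → (Fin d → ℝ) → ℂ} (hg : ∀ p, AnalyticAt ℝ (g p) x₁.2) :
    ∃ ρ > 0, Metric.ball x₁ ρ ⊆ X ∧ ∃ U : Pt d → ℂ, AnalyticOnNhd ℝ U (Metric.ball x₁ ρ) ∧
      (∀ x ∈ Metric.ball x₁ ρ, opFun m G U x = 0) ∧
      ∀ (p : Fin m), ∀ y ∈ Metric.ball x₁.2 ρ, partialD (p : ℕ) 0 U (x₁.1, y) = g p y := by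
  set V := negTaylor x₁.1 g with hV
  have hVx := analyticAt_negTaylor (t₁ := x₁.1) hg
  -- the equation satisfied by the unknown after subtraction of the Taylor polynomial
  let F : Pt d × (JetIndex d m → ℂ) → ℂ := fun z =>
    G (z.1, fun a => z.2 a - partialD (a.1.1 : ℕ) (fun i => (a.1.2 i : ℕ)) V z.1) +
      partialD m 0 V z.1
  have hF : AnalyticAt ℝ F (x₁, 0) := by
    have hfst : AnalyticAt ℝ (fun z : Pt d × (JetIndex d m → ℂ) => z.1) (x₁, 0) := analyticAt_fst
    refine AnalyticAt.add ?_ ((partialD_analyticAt hVx m 0).comp_of_eq hfst rfl)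
    refine AnalyticAt.comp (hG _ ⟨hx₁, mem_univ _⟩) (hfst.prod (AnalyticAt.pi fun a => ?_))
    refine AnalyticAt.sub ?_ ((partialD_analyticAt hVx _ _).comp_of_eq hfst rfl)
    exact ((ContinuousLinearMap.proj (R := ℝ) (φ := fun _ : JetIndex d m => ℂ) a).comp
      (ContinuousLinearMap.snd ℝ (Pt d) (JetIndex d m → ℂ))).analyticAt _
  obtain ⟨Ω, hΩ, hxΩ, W, hW, hWeq, hW0⟩ := exists_local_solution_zero hF
  have hgev : ∀ᶠ x : Pt d in 𝓝 x₁, ∀ p, AnalyticAt ℝ (g p) x.2 :=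
    continuous_snd.continuousAt.eventually
      (eventually_all.2 fun p => (hg p).eventually_analyticAt)
  obtain ⟨ρ, hρ, hball⟩ := Metric.eventually_nhds_iff_ball.1
    (((show ∀ᶠ x in 𝓝 x₁, x ∈ Ω from hΩ.mem_nhds hxΩ).and hgev).and
      (show ∀ᶠ x in 𝓝 x₁, x ∈ X from X.isOpen.mem_nhds hx₁))
  have hVan : ∀ x ∈ Metric.ball x₁ ρ, AnalyticAt ℝ V x := fun x hx =>
    analyticAt_negTaylor (hball x hx).1.2
  refine ⟨ρ, hρ, fun x hx => (hball x hx).2, W - V, fun x hx =>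
    (hW x (hball x hx).1.1).sub (hVan x hx), fun x hx => ?_, fun p y hy => ?_⟩
  · have h1 := hWeq x (hball x hx).1.1
    have hs := partialD_sub (hW x (hball x hx).1.1) (hVan x hx)
    simp only [opFun, jet, hs, h1, F]
    ring
  · have hx : ((x₁.1, y) : Pt d) ∈ Metric.ball x₁ ρ := by
      rw [Metric.mem_ball, Prod.dist_eq, dist_self]
      exact max_lt hρ hy
    rw [partialD_sub (hW _ (hball _ hx).1.1) (hVan _ hx), hW0 p p.2 _ (hball _ hx).1.1 rfl,
      partialD_negTaylor (hball _ hx).1.2, zero_sub, neg_neg]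

/-! ### Uniqueness of analytic solutions -/

lemma isBigO_of_iteratedDeriv_eq_zero {f : ℝ → ℂ} {t : ℝ} (hf : AnalyticAt ℝ f t) {n : ℕ}
    (h : ∀ i < n, iteratedDeriv i f t = 0) : f =O[𝓝 t] fun u => (u - t) ^ n := by
  obtain ⟨g, hg, hfg⟩ := (natCast_le_analyticOrderAt hf).1
    ((natCast_le_analyticOrderAt_iff_iteratedDeriv_eq_zero hf).2 h)
  have h1 : (fun u => (u - t) ^ n • g u) =O[𝓝 t] fun u => (u - t) ^ n • (1 : ℝ) :=
    (Asymptotics.isBigO_refl _ _).smul (hg.continuousAt.isBigO_one ℝ)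
  simp only [smul_eq_mul, mul_one] at h1
  exact (Filter.EventuallyEq.trans_isBigO hfg h1)

lemma iteratedDeriv_eq_zero_of_isBigO {f : ℝ → ℂ} {t : ℝ} (hf : AnalyticAt ℝ f t) {n : ℕ}
    (h : f =O[𝓝 t] fun u => (u - t) ^ n) : ∀ i < n, iteratedDeriv i f t = 0 := by
  rw [← natCast_le_analyticOrderAt_iff_iteratedDeriv_eq_zero hf]
  by_contra! hlt
  obtain ⟨i, hi⟩ := ENat.ne_top_iff_exists.1 hlt.ne_top
  rw [← hi] at hlt
  have hin : i < n := by exact_mod_cast hlt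
  obtain ⟨g, hg, hg0, hfg⟩ := hf.analyticOrderAt_eq_natCast.1 hi.symm
  refine hg0 ?_
  have h1 : g =O[𝓝[≠] t] fun u => (u - t) ^ (n - i) := by
    obtain ⟨C, hC⟩ := h.bound
    refine Asymptotics.IsBigO.of_bound C ?_
    filter_upwards [nhdsWithin_le_nhds hC, nhdsWithin_le_nhds hfg, self_mem_nhdsWithin]
      with u h1 h2 h3
    have h4 : 0 < ‖(u - t) ^ i‖ := norm_pos_iff.2 (pow_ne_zero _ (sub_ne_zero.2 h3))
    rw [h2, norm_smul, ← Nat.sub_add_cancel hin.le, pow_add, norm_mul] at h1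
    refine le_of_mul_le_mul_left ?_ h4
    calc _ ≤ _ := h1
      _ = _ := by ring
  have h2 : Tendsto (fun u : ℝ => (u - t) ^ (n - i)) (𝓝[≠] t) (𝓝 0) := by
    have : Tendsto (fun u : ℝ => (u - t) ^ (n - i)) (𝓝 t) (𝓝 ((t - t) ^ (n - i))) :=
      ((continuous_id.sub continuous_const).pow _).tendsto t
    rw [sub_self, zero_pow (Nat.sub_ne_zero_of_lt hin)] at this
    exact this.mono_left nhdsWithin_le_nhds
  exact tendsto_nhds_unique (hg.continuousAt.tendsto.mono_left nhdsWithin_le_nhds)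
    (h1.trans_tendsto h2)

/-- Derivatives along the hyperplane `t = t₀` of a function that vanishes on it vanish on it. -/
lemma listD_eq_zero_of_slice {f : Pt d → ℂ} {t₀ : ℝ} {V : Set (Fin d → ℝ)} (hV : IsOpen V)
    (hf : ∀ y ∈ V, AnalyticAt ℝ f (t₀, y)) (h0 : ∀ y ∈ V, f (t₀, y) = 0) {l : List (Pt d)}
    (hl : ∀ v ∈ l, v.1 = 0) : ∀ y ∈ V, listD l f (t₀, y) = 0 := by
  induction l with
  | nil => exact h0
  | cons v l ih =>
    intro y hy
    have ih' := ih fun w hw => hl w (List.mem_cons_of_mem _ hw)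
    have h1 : HasLineDerivAt ℝ (listD l f) (listD (v :: l) f (t₀, y)) (t₀, y) v :=
      (listD_analyticAt (hf y hy) l).differentiableAt.hasFDerivAt.hasLineDerivAt v
    refine HasDerivAt.unique h1 ((hasDerivAt_const (0 : ℝ) (0 : ℂ)).congr_of_eventuallyEq ?_)
    have hc : ContinuousAt (fun u : ℝ => y + u • v.2) 0 := by fun_prop
    have hm : ∀ᶠ u : ℝ in 𝓝 0, y + u • v.2 ∈ V :=
      hc.eventually (hV.mem_nhds (by simpa using hy))
    filter_upwards [hm] with u hu
    have : ((t₀, y) : Pt d) + u • v = (t₀, y + u • v.2) := by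
      refine Prod.ext ?_ rfl
      simp [hl v List.mem_cons_self]
    rw [this, ih' _ hu]

lemma Dt_iterate_partialD_eq_zero {f : Pt d → ℂ} {t₀ : ℝ} {V : Set (Fin d → ℝ)} (hV : IsOpen V)
    (hf : ∀ y ∈ V, AnalyticAt ℝ f (t₀, y)) {j p : ℕ} (q : Fin d → ℕ)
    (h0 : ∀ y ∈ V, Dt^[p + j] f (t₀, y) = 0) :
    ∀ y ∈ V, Dt^[j] (partialD p q f) (t₀, y) = 0 := by
  intro y hy
  set Y : List (Pt d) := (List.finRange d).flatMap fun i =>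
    List.replicate (q i) (0, Pi.single i 1) with hY
  have hYz : ∀ v ∈ Y, v.1 = 0 := by
    intro v hv
    obtain ⟨i, -, hi⟩ := List.mem_flatMap.1 hv
    rw [List.eq_of_mem_replicate hi]
  have e1 : Dt^[j] (partialD p q f) = listD (List.replicate j (1, 0) ++ dirList p q) f := by
    rw [listD_append, listD_replicate, partialD_eq_listD]; rfl
  have e2 : Dt^[p + j] f = listD (List.replicate (p + j) (1, 0)) f := by
    rw [listD_replicate]; rfl
  have hperm : (List.replicate j ((1, 0) : Pt d) ++ dirList p q).Perm
      (Y ++ List.replicate (p + j) (1, 0)) := by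
    rw [dirList, ← List.append_assoc, ← List.replicate_add, add_comm j p]
    exact List.perm_append_comm
  rw [e1, listD_perm hperm (eventually_contDiffAt (hf y hy)), listD_append, ← e2]
  exact listD_eq_zero_of_slice hV (fun y hy => Dt_iterate_analyticAt (hf y hy) _) h0 hYz y hy

/-- Two analytic solutions with the same initial values on `t = t₀` have the same `t`-derivatives
of all orders there: once those of order less than `k` agree, the jets entering `G` agree up to
`O((t - t₀)^(k - m + 1))`, and the equation gives the derivative of order `k`. -/
lemma Dt_iterate_sub_eq_zero {X : Opens (Pt d)} {G : Pt d × (JetIndex d m → ℂ) → ℂ}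
    (hG : AnalyticOnNhd ℝ G ((X : Set (Pt d)) ×ˢ univ)) {t₀ : ℝ} {I : Set ℝ}
    {V : Set (Fin d → ℝ)} (hI : IsOpen I) (ht₀ : t₀ ∈ I) (hV : IsOpen V)
    (hX : I ×ˢ V ⊆ (X : Set (Pt d))) {U W : Pt d → ℂ} (hU : AnalyticOnNhd ℝ U (I ×ˢ V))
    (hW : AnalyticOnNhd ℝ W (I ×ˢ V)) (hUeq : ∀ x ∈ I ×ˢ V, opFun m G U x = 0)
    (hWeq : ∀ x ∈ I ×ˢ V, opFun m G W x = 0)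
    (hUW : ∀ p < m, ∀ y ∈ V, partialD p 0 U (t₀, y) = partialD p 0 W (t₀, y)) (k : ℕ) :
    ∀ y ∈ V, Dt^[k] (U - W) (t₀, y) = 0 := by
  have hD : AnalyticOnNhd ℝ (U - W) (I ×ˢ V) := hU.sub hW
  induction k using Nat.strong_induction_on with
  | _ k ih =>
  intro y hy
  have hxy : (t₀, y) ∈ I ×ˢ V := ⟨ht₀, hy⟩
  rcases lt_or_ge k m with hk | hk
  · rw [← partialD_zero_right, partialD_sub (hU _ hxy) (hW _ hxy), hUW k hk y hy, sub_self]
  have hIn : ∀ᶠ t in 𝓝 t₀, (t, y) ∈ I ×ˢ V :=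
    (show ∀ᶠ t in 𝓝 t₀, t ∈ I from hI.mem_nhds ht₀).mono fun t ht => ⟨ht, hy⟩
  have hcomp : ∀ (a : JetIndex d m) (j : ℕ), (a.1.1 : ℕ) + j < k →
      Dt^[j] (partialD (a.1.1 : ℕ) (fun i => (a.1.2 i : ℕ)) (U - W)) (t₀, y) = 0 :=
    fun a j hj => Dt_iterate_partialD_eq_zero hV (fun y hy => hD _ ⟨ht₀, hy⟩) _
      (fun y hy => ih _ hj y hy) y hy
  have hjetO : ∀ a : JetIndex d m, (fun t => (jet m U (t, y)).2 a - (jet m W (t, y)).2 a)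
      =O[𝓝 t₀] fun t => (t - t₀) ^ (k - m + 1) := fun a => by
    have ha := partialD_analyticAt (hD _ hxy) (a.1.1 : ℕ) (fun i => (a.1.2 i : ℕ))
    have h1 := isBigO_of_iteratedDeriv_eq_zero (n := k - m + 1) (analyticAt_slice ha)
      fun i hi => by
        rw [← Dt_iterate_eq_iteratedDeriv i ha]
        have := a.1.1.2
        exact hcomp a i (by omega)
    refine Filter.EventuallyEq.trans_isBigO ?_ h1
    filter_upwards [hIn] with t ht
    exact (partialD_sub (hU _ ht) (hW _ ht) _ _).symm
  have hjet0 : jet m U (t₀, y) = jet m W (t₀, y) := by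
    refine Prod.ext rfl (funext fun a => sub_eq_zero.1 ?_)
    have := a.1.1.2
    have h1 := hcomp a 0 (by omega)
    rw [Function.iterate_zero_apply, partialD_sub (hU _ hxy) (hW _ hxy)] at h1
    exact h1
  have hjetc : ∀ {f : Pt d → ℂ}, AnalyticAt ℝ f (t₀, y) →
      Tendsto (fun t => jet m f (t, y)) (𝓝 t₀) (𝓝 (jet m f (t₀, y))) := fun hf => by
    have h1 : ContinuousAt (jet m _) (t₀, y) := (jet_contDiffAt hf.contDiffAt).continuousAt
    have h2 : Tendsto (fun t : ℝ => ((t, y) : Pt d)) (𝓝 t₀) (𝓝 (t₀, y)) :=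
      Continuous.tendsto (by fun_prop) t₀
    exact h1.tendsto.comp h2
  have hGc : ContDiffAt ℝ 1 G (jet m U (t₀, y)) :=
    (hG _ ⟨hX hxy, mem_univ _⟩).contDiffAt
  obtain ⟨C, N, hN, hlip⟩ := hGc.exists_lipschitzOnWith
  have hWN := hjetc (hW _ hxy)
  rw [← hjet0] at hWN
  have hO : (fun t => Dt^[m] (U - W) (t, y)) =O[𝓝 t₀] fun t => (t - t₀) ^ (k - m + 1) := by
    have h1 : (fun t => Dt^[m] (U - W) (t, y)) =O[𝓝 t₀]
        fun t => (jet m U (t, y)).2 - (jet m W (t, y)).2 := by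
      refine Asymptotics.IsBigO.of_bound C ?_
      filter_upwards [hIn, hjetc (hU _ hxy) hN, hWN hN] with t ht hu hw
      have h2 := hlip.dist_le_mul _ hu _ hw
      have e : Dt^[m] (U - W) (t, y) = G (jet m U (t, y)) - G (jet m W (t, y)) := by
        rw [← partialD_zero_right, partialD_sub (hU _ ht) (hW _ ht),
          sub_eq_zero.1 (hUeq _ ht), sub_eq_zero.1 (hWeq _ ht)]
      rw [e, ← dist_eq_norm]
      refine h2.trans (mul_le_mul_of_nonneg_left ?_ C.2)
      rw [Prod.dist_eq, ← dist_eq_norm]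
      exact max_le (by simp [jet]) le_rfl
    exact h1.trans (Asymptotics.isBigO_pi.2 hjetO)
  have hm := Dt_iterate_analyticAt (hD _ hxy) m
  have h3 := iteratedDeriv_eq_zero_of_isBigO (analyticAt_slice hm) hO (k - m) (by omega)
  rw [← Dt_iterate_eq_iteratedDeriv _ hm, ← Function.iterate_add_apply,
    Nat.sub_add_cancel hk] at h3
  exact h3

/-- Uniqueness of analytic solutions of the initial value problem on a product set. -/
lemma eqOn_of_initial_values {X : Opens (Pt d)} {G : Pt d × (JetIndex d m → ℂ) → ℂ}
    (hG : AnalyticOnNhd ℝ G ((X : Set (Pt d)) ×ˢ univ)) {t₀ : ℝ} {I : Set ℝ}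
    {V : Set (Fin d → ℝ)} (hI : IsOpen I) (hIc : IsPreconnected I) (ht₀ : t₀ ∈ I) (hV : IsOpen V)
    (hX : I ×ˢ V ⊆ (X : Set (Pt d))) {U W : Pt d → ℂ} (hU : AnalyticOnNhd ℝ U (I ×ˢ V))
    (hW : AnalyticOnNhd ℝ W (I ×ˢ V)) (hUeq : ∀ x ∈ I ×ˢ V, opFun m G U x = 0)
    (hWeq : ∀ x ∈ I ×ˢ V, opFun m G W x = 0)
    (hUW : ∀ p < m, ∀ y ∈ V, partialD p 0 U (t₀, y) = partialD p 0 W (t₀, y)) :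
    EqOn U W (I ×ˢ V) := by
  have hD : AnalyticOnNhd ℝ (U - W) (I ×ˢ V) := hU.sub hW
  rintro ⟨t, y⟩ ⟨ht, hy⟩
  have h1 : AnalyticAt ℝ (fun u => (U - W) (u, y)) t₀ := analyticAt_slice (hD _ ⟨ht₀, hy⟩)
  have h2 : analyticOrderAt (fun u => (U - W) (u, y)) t₀ = ⊤ := by
    refine ENat.eq_top_iff_forall_ge.2 fun n => ?_
    refine (natCast_le_analyticOrderAt_iff_iteratedDeriv_eq_zero h1).2 fun i _ => ?_
    rw [← Dt_iterate_eq_iteratedDeriv i (hD _ ⟨ht₀, hy⟩)]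
    exact Dt_iterate_sub_eq_zero hG hI ht₀ hV hX hU hW hUeq hWeq hUW i y hy
  have h3 : AnalyticOnNhd ℝ (fun u => (U - W) (u, y)) I := fun u hu =>
    analyticAt_slice (hD _ ⟨hu, hy⟩)
  exact sub_eq_zero.1 (h3.eqOn_zero_of_preconnected_of_eventuallyEq_zero hIc ht₀
    (analyticOrderAt_eq_top.1 h2) ht)

/-! ### The solution off a closed null set -/

/-- The local solutions with centres on `t = t₀` agree on overlaps, which are products of a
`t`-interval around `t₀` and an open set, and hence glue together. -/
lemma exists_solution_near_hypersurface {X : Opens (Pt d)} {G : Pt d × (JetIndex d m → ℂ) → ℂ}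
    (hG : AnalyticOnNhd ℝ G ((X : Set (Pt d)) ×ˢ univ)) (t₀ : ℝ) {g : Fin m → (Fin d → ℝ) → ℂ}
    (hg : ∀ p, AnalyticOnNhd ℝ (g p) {y | (t₀, y) ∈ X}) :
    ∃ N : Set (Pt d), IsOpen N ∧ (∀ x ∈ X, x.1 = t₀ → x ∈ N) ∧ ∃ Ψ : Pt d → ℂ,
      AnalyticOnNhd ℝ Ψ N ∧ (∀ x ∈ N, opFun m G Ψ x = 0) ∧
      ∀ (p : Fin m) (y : Fin d → ℝ), (t₀, y) ∈ X → partialD (p : ℕ) 0 Ψ (t₀, y) = g p y := by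
  classical
  have hloc : ∀ y : {y : Fin d → ℝ // ((t₀, y) : Pt d) ∈ X}, _ := fun y =>
    exists_local_solution hG y.2 (g := g) fun p => hg p y.1 y.2
  choose ρ hρ hball U hU hUeq hUg using hloc
  let D : {y : Fin d → ℝ // ((t₀, y) : Pt d) ∈ X} → Set (Pt d) := fun y =>
    Metric.ball ((t₀, y.1) : Pt d) (ρ y)
  have hprod : ∀ y, D y = Metric.ball t₀ (ρ y) ×ˢ Metric.ball y.1 (ρ y) := fun y =>
    (ball_prod_same _ _ _).symm
  -- two local solutions agree on the common part of their domains
  have hagree : ∀ y z, EqOn (U y) (U z) (D y ∩ D z) := by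
    intro y z
    have hsy : D y ∩ D z ⊆ D y := inter_subset_left
    have hsz : D y ∩ D z ⊆ D z := inter_subset_right
    have e : D y ∩ D z = (Metric.ball t₀ (ρ y) ∩ Metric.ball t₀ (ρ z)) ×ˢ
        (Metric.ball y.1 (ρ y) ∩ Metric.ball z.1 (ρ z)) := by
      rw [hprod, hprod, prod_inter_prod]
    rw [e] at hsy hsz ⊢
    refine eqOn_of_initial_values (t₀ := t₀) hG (Metric.isOpen_ball.inter Metric.isOpen_ball)
      ((convex_ball _ _).inter (convex_ball _ _)).isPreconnected
      ⟨Metric.mem_ball_self (hρ y), Metric.mem_ball_self (hρ z)⟩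
      (Metric.isOpen_ball.inter Metric.isOpen_ball) (hsy.trans (hball y))
      (fun x hx => hU y x (hsy hx)) (fun x hx => hU z x (hsz hx))
      (fun x hx => hUeq y x (hsy hx)) (fun x hx => hUeq z x (hsz hx)) fun p hp w hw => ?_
    exact (hUg y ⟨p, hp⟩ w hw.1).trans (hUg z ⟨p, hp⟩ w hw.2).symm
  let Ψ : Pt d → ℂ := fun x => if h : ∃ y, x ∈ D y then U h.choose x else 0
  have hΨ : ∀ y, EqOn Ψ (U y) (D y) := by
    intro y x hx
    have h : ∃ y, x ∈ D y := ⟨y, hx⟩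
    simp only [Ψ, dif_pos h]
    exact hagree _ _ ⟨h.choose_spec, hx⟩
  have hΨe : ∀ y, ∀ x ∈ D y, Ψ =ᶠ[𝓝 x] U y := fun y x hx =>
    (hΨ y).eventuallyEq_of_mem (Metric.isOpen_ball.mem_nhds hx)
  refine ⟨⋃ y, D y, isOpen_iUnion fun y => Metric.isOpen_ball, fun x hx hx1 => ?_, Ψ, ?_, ?_, ?_⟩
  · obtain ⟨t, y⟩ := x
    obtain rfl : t = t₀ := hx1
    exact mem_iUnion.2 ⟨⟨y, hx⟩, Metric.mem_ball_self (hρ _)⟩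
  · intro x hx
    obtain ⟨y, hy⟩ := mem_iUnion.1 hx
    exact (hU y x hy).congr (hΨe y x hy).symm
  · intro x hx
    obtain ⟨y, hy⟩ := mem_iUnion.1 hx
    rw [opFun_congr (hΨe y x hy)]
    exact hUeq y x hy
  · intro p y hy
    rw [partialD_congr (hΨe ⟨y, hy⟩ _ (Metric.mem_ball_self (hρ _)))]
    exact hUg ⟨y, hy⟩ p y (Metric.mem_ball_self (hρ _))

/-- A neighbourhood of the part of the hyperplane `t = t₀` contained in `N` can be shrunk to one
whose boundary points off the hyperplane form a null set. -/
lemma exists_shrink_null_frontier {N : Set (Pt d)} (hN : IsOpen N) (t₀ : ℝ) :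
    ∃ N' : Set (Pt d), IsOpen N' ∧ N' ⊆ N ∧ (∀ x ∈ N, x.1 = t₀ → x ∈ N') ∧
      volume ((closure N' \ N') ∩ {x | x.1 ≠ t₀}) = 0 := by
  obtain ⟨φ, hφN, hφ, hφr⟩ := hN.exists_contDiff_support_eq (n := 0)
  have hφ0 : ∀ x, 0 ≤ φ x := fun x => (hφr (mem_range_self x)).1
  have hφc : Continuous φ := hφ.continuous
  have hmeas : Measurable fun x : Pt d => |x.1 - t₀| / φ x :=
    ((measurable_fst.sub_const t₀).abs).div hφc.measurable
  -- almost every level set is a null set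
  obtain ⟨c, hc, hc0⟩ := ((Measure.countable_meas_level_set_pos (μ := volume) hmeas).dense_compl
    ℝ).exists_mem_open isOpen_Ioi ⟨1, mem_Ioi.2 one_pos⟩
  have hnull : volume {x : Pt d | |x.1 - t₀| / φ x = c} = 0 := by
    simpa using hc
  have hcl : Continuous fun x : Pt d => |x.1 - t₀| := by fun_prop
  have hcr : Continuous fun x : Pt d => c * φ x := by fun_prop
  have hc0' : 0 < c := hc0
  refine ⟨{x | |x.1 - t₀| < c * φ x}, isOpen_lt hcl hcr, fun x hx => ?_, fun x hx hx1 => ?_, ?_⟩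
  · rw [← hφN, Function.mem_support]
    intro h0
    rw [mem_ofPred_eq, h0, mul_zero] at hx
    exact absurd hx (abs_nonneg _).not_gt
  · rw [← hφN, Function.mem_support] at hx
    rw [mem_ofPred_eq, hx1, sub_self, abs_zero]
    exact mul_pos hc0' (lt_of_le_of_ne (hφ0 x) hx.symm)
  · refine measure_mono_null ?_ hnull
    rintro x ⟨⟨h1, h2⟩, h3⟩
    have h4 : |x.1 - t₀| ≤ c * φ x :=
      closure_minimal (fun x hx => le_of_lt hx) (isClosed_le hcl hcr) h1
    have h5 : |x.1 - t₀| = c * φ x := le_antisymm h4 (not_lt.1 h2)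
    have h6 : φ x ≠ 0 := by
      intro h0
      rw [h0, mul_zero, abs_eq_zero, sub_eq_zero] at h5
      exact h3 h5
    rw [mem_ofPred_eq, h5, mul_div_assoc, div_self h6, mul_one]

/-- A locally finite cover of an open set by countably many small balls. -/
lemma exists_locallyFinite_balls {O : Set (Pt d)} (hO : IsOpen O) {R : Pt d → ℝ}
    (hR : ∀ x ∈ O, 0 < R x) (hRO : ∀ x ∈ O, Metric.ball x (R x) ⊆ O) :
    ∃ (α : Type) (_ : Countable α) (c : α → Pt d) (r : α → ℝ),
      (∀ a, c a ∈ O ∧ r a ≤ R (c a)) ∧ (∀ x ∈ O, ∃ a, x ∈ Metric.ball (c a) (r a)) ∧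
      ∀ x ∈ O, ∃ W, IsOpen W ∧ x ∈ W ∧ {a | (Metric.ball (c a) (r a) ∩ W).Nonempty}.Finite := by
  have hlc : LocallyCompactSpace O := hO.locallyCompactSpace
  have hB : ∀ x : O, (𝓝 x).HasBasis (fun r : ℝ => 0 < r ∧ r ≤ R x) fun r => Metric.ball x r := by
    intro x
    refine Metric.nhds_basis_ball.to_hasBasis (fun r hr => ?_) fun r hr => ⟨r, hr.1, le_rfl⟩
    exact ⟨min r (R x), ⟨lt_min hr (hR x x.2), min_le_right _ _⟩,
      Metric.ball_subset_ball (min_le_left _ _)⟩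
  obtain ⟨α, c, r, hr, hcov, hlf⟩ := refinement_of_locallyCompact_sigmaCompact_of_nhds_basis hB
  have hcount : Countable α := countable_univ_iff.1
    (hlf.countable_univ fun a => ⟨c a, Metric.mem_ball_self (hr a).1⟩)
  have hsub : ∀ a, ∀ y ∈ Metric.ball (c a : Pt d) (r a), y ∈ O := fun a y hy =>
    hRO (c a) (c a).2 (Metric.ball_subset_ball (hr a).2 hy)
  refine ⟨α, hcount, fun a => c a, r, fun a => ⟨(c a).2, (hr a).2⟩, fun x hx => ?_,
    fun x hx => ?_⟩
  · have h1 : (⟨x, hx⟩ : O) ∈ ⋃ a, Metric.ball (c a) (r a) := by rw [hcov]; trivial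
    obtain ⟨a, ha⟩ := mem_iUnion.1 h1
    exact ⟨a, ha⟩
  · obtain ⟨W, hW, hfin⟩ := hlf ⟨x, hx⟩
    obtain ⟨W', hW'W, hW', hxW'⟩ := mem_nhds_iff.1 hW
    refine ⟨Subtype.val '' W', hO.isOpenMap_subtype_val _ hW', ⟨_, hxW', rfl⟩,
      hfin.subset ?_⟩
    rintro a ⟨_, hy, ⟨z, hz, rfl⟩⟩
    exact ⟨z, hy, hW'W hz⟩

/-- Off the boundaries of a locally finite family of balls, the set of the balls that contain a
point is locally constant, and the complement of the boundaries is open. -/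
lemma eventually_mem_ball_iff {α : Type} {c : α → Pt d} {r : α → ℝ} {x : Pt d}
    (hfin : ∃ W, IsOpen W ∧ x ∈ W ∧ {a | (Metric.ball (c a) (r a) ∩ W).Nonempty}.Finite)
    (hx : ∀ a, x ∉ frontier (Metric.ball (c a) (r a))) :
    ∀ᶠ y in 𝓝 x, ∀ a, (y ∈ Metric.ball (c a) (r a) ↔ x ∈ Metric.ball (c a) (r a)) ∧
      y ∉ frontier (Metric.ball (c a) (r a)) := by
  obtain ⟨W, hW, hxW, hf⟩ := hfin
  have h1 : ∀ᶠ y in 𝓝 x, ∀ a ∈ {a | (Metric.ball (c a) (r a) ∩ W).Nonempty},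
      (y ∈ Metric.ball (c a) (r a) ↔ x ∈ Metric.ball (c a) (r a)) ∧
      y ∉ frontier (Metric.ball (c a) (r a)) := by
    refine (eventually_all_finite hf).2 fun a _ => ?_
    refine Eventually.and ?_ (isClosed_frontier.isOpen_compl.mem_nhds (hx a))
    by_cases ha : x ∈ Metric.ball (c a) (r a)
    · filter_upwards [Metric.isOpen_ball.mem_nhds ha] with y hy
      exact ⟨fun _ => ha, fun _ => hy⟩
    · have ha' : x ∉ closure (Metric.ball (c a) (r a)) := fun h =>
        hx a (by rw [Metric.isOpen_ball.frontier_eq]; exact ⟨h, ha⟩)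
      filter_upwards [isClosed_closure.isOpen_compl.mem_nhds ha'] with y hy
      exact ⟨fun h => absurd (subset_closure h) hy, fun h => absurd h ha⟩
  filter_upwards [h1, hW.mem_nhds hxW] with y hy hyW a
  by_cases ha : (Metric.ball (c a) (r a) ∩ W).Nonempty
  · exact hy a ha
  · have hd : Disjoint (Metric.ball (c a) (r a)) W :=
      disjoint_iff_inter_eq_empty.2 (not_nonempty_iff_eq_empty.1 ha)
    have hcl := hd.closure_left hW
    exact ⟨⟨fun h => absurd hyW (hd.notMem_of_mem_left h),
      fun h => absurd hxW (hd.notMem_of_mem_left h)⟩,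
      fun h => hcl.notMem_of_mem_left (frontier_subset_closure h) hyW⟩

/-- The solution of the initial value problem off a closed null set. Near the initial hypersurface
it is the Cauchy–Kovalevskaya solution; elsewhere arbitrary local solutions on the balls of a
locally finite family are put side by side. -/
lemma exists_solution_off_null {X : Opens (Pt d)} {G : Pt d × (JetIndex d m → ℂ) → ℂ}
    (hG : AnalyticOnNhd ℝ G ((X : Set (Pt d)) ×ˢ univ)) (t₀ : ℝ) {g : Fin m → (Fin d → ℝ) → ℂ}
    (hg : ∀ p, AnalyticOnNhd ℝ (g p) {y | (t₀, y) ∈ X}) :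
    ∃ Y : Set (Pt d), IsOpen Y ∧ volume ((X : Set (Pt d)) \ Y) = 0 ∧
      (∀ x ∈ X, x.1 = t₀ → x ∈ Y) ∧ ∃ ψ : Pt d → ℂ,
      AnalyticOnNhd ℝ ψ Y ∧ (∀ x ∈ Y, opFun m G ψ x = 0) ∧
      ∀ (p : Fin m) (y : Fin d → ℝ), (t₀, y) ∈ X → partialD (p : ℕ) 0 ψ (t₀, y) = g p y := by
  classical
  obtain ⟨N, hN, hSN, Ψ, hΨ, hΨeq, hΨg⟩ := exists_solution_near_hypersurface hG t₀ hg
  obtain ⟨N', hN', hN'N, hSN', hN'null⟩ := exists_shrink_null_frontier hN t₀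
  have hS : ∀ x ∈ X, x.1 = t₀ → x ∈ N' := fun x hx hx1 => hSN' x (hSN x hx hx1) hx1
  set O : Set (Pt d) := (X : Set (Pt d)) ∩ {x | x.1 ≠ t₀} with hOdef
  have hO : IsOpen O := X.isOpen.inter (isOpen_ne_fun continuous_fst continuous_const)
  have hloc : ∀ x : Pt d, ∃ (R : ℝ) (U : Pt d → ℂ), x ∈ O → 0 < R ∧ Metric.ball x R ⊆ O ∧
      AnalyticOnNhd ℝ U (Metric.ball x R) ∧ ∀ y ∈ Metric.ball x R, opFun m G U y = 0 := by
    intro x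
    by_cases hx : x ∈ O
    · obtain ⟨ρ, hρ, -, U, hU, hUeq, -⟩ := exists_local_solution hG hx.1
        (g := fun _ _ => 0) fun _ => analyticAt_const
      obtain ⟨ε, hε, hεO⟩ := Metric.isOpen_iff.1 hO x hx
      have h1 : Metric.ball x (min ρ ε) ⊆ Metric.ball x ρ :=
        Metric.ball_subset_ball (min_le_left _ _)
      exact ⟨min ρ ε, U, fun _ => ⟨lt_min hρ hε,
        (Metric.ball_subset_ball (min_le_right _ _)).trans hεO, fun y hy => hU y (h1 hy),
        fun y hy => hUeq y (h1 hy)⟩⟩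
    · exact ⟨0, 0, fun h => absurd h hx⟩
  choose R U hRU using hloc
  obtain ⟨α, hα, c, r, hcr, hcov, hfin⟩ := exists_locallyFinite_balls hO
    (fun x hx => (hRU x hx).1) fun x hx => (hRU x hx).2.1
  let B : α → Set (Pt d) := fun a => Metric.ball (c a) (r a)
  have hBR : ∀ a, B a ⊆ Metric.ball (c a) (R (c a)) := fun a => Metric.ball_subset_ball (hcr a).2
  -- the points of `O` off the boundary of `N'` and off all the boundaries of the balls
  let Z : Set (Pt d) := {x | x ∈ O ∧ x ∉ closure N' ∧ ∀ a, x ∉ frontier (B a)}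
  have hZev : ∀ x ∈ Z, ∀ᶠ y in 𝓝 x, y ∈ Z ∧ {a | y ∈ B a} = {a | x ∈ B a} := by
    rintro x ⟨hxO, hxN, hxB⟩
    filter_upwards [hO.mem_nhds hxO, isClosed_closure.isOpen_compl.mem_nhds hxN,
      eventually_mem_ball_iff (hfin x hxO) hxB] with y h1 h2 h3
    exact ⟨⟨h1, h2, fun a => (h3 a).2⟩, Set.ext fun a => (h3 a).1⟩
  have hZ : IsOpen Z := isOpen_iff_mem_nhds.2 fun x hx => (hZev x hx).mono fun y hy => hy.1
  -- a choice of a ball, depending only on the set of all balls that contain the point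
  let pick : Set α → Option α := fun s => if h : s.Nonempty then some h.choose else none
  let ψ : Pt d → ℂ := fun x => if x ∈ N' then Ψ x else
    match pick {a | x ∈ B a} with
    | some a => U (c a) x
    | none => 0
  have hψN : ∀ x ∈ N', ψ =ᶠ[𝓝 x] Ψ := fun x hx => by
    filter_upwards [hN'.mem_nhds hx] with y hy
    simp only [ψ, if_pos hy]
  have hψZ : ∀ x ∈ Z, ∃ a, x ∈ B a ∧ ψ =ᶠ[𝓝 x] U (c a) := by
    intro x hx
    have hne : {a | x ∈ B a}.Nonempty := hcov x hx.1
    refine ⟨hne.choose, hne.choose_spec, ?_⟩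
    have hp : pick {a | x ∈ B a} = some hne.choose := dif_pos hne
    filter_upwards [hZev x hx] with y hy
    have hyN : y ∉ N' := fun h => hy.1.2.1 (subset_closure h)
    simp only [ψ, if_neg hyN, hy.2, hp]
  refine ⟨N' ∪ Z, hN'.union hZ, ?_, fun x hx hx1 => Or.inl (hS x hx hx1), ψ, ?_, ?_, ?_⟩
  · have hsub : (X : Set (Pt d)) \ (N' ∪ Z) ⊆
        ((closure N' \ N') ∩ {x | x.1 ≠ t₀}) ∪ ⋃ a, frontier (B a) := by
      rintro x ⟨hx, hxY⟩
      rw [mem_union, not_or] at hxY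
      have hx1 : x.1 ≠ t₀ := fun h => hxY.1 (hS x hx h)
      by_cases h1 : x ∈ closure N'
      · exact Or.inl ⟨⟨h1, hxY.1⟩, hx1⟩
      · by_contra h2
        rw [mem_union, not_or, mem_iUnion, not_exists] at h2
        exact hxY.2 ⟨⟨hx, hx1⟩, h1, h2.2⟩
    refine measure_mono_null hsub (measure_union_null hN'null (measure_iUnion_null fun a => ?_))
    rw [Measure.volume_eq_prod]
    exact (convex_ball (c a) (r a)).addHaar_frontier _
  · rintro x (hx | hx)
    · exact (hΨ x (hN'N hx)).congr (hψN x hx).symm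
    · obtain ⟨a, hxa, he⟩ := hψZ x hx
      exact ((hRU _ (hcr a).1).2.2.1 x (hBR a hxa)).congr he.symm
  · rintro x (hx | hx)
    · rw [opFun_congr (hψN x hx)]
      exact hΨeq x (hN'N hx)
    · obtain ⟨a, hxa, he⟩ := hψZ x hx
      rw [opFun_congr he]
      exact (hRU _ (hcr a).1).2.2.2 x (hBR a hxa)
  · intro p y hy
    rw [partialD_congr (hψN _ (hS _ hy rfl))]
    exact hΨg p y hy

/-! ### Smooth approximation and the generalized solution -/

/-- A smooth function on an open set `Y` agrees on every compact subset of `Y` with almost all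
terms of a sequence of functions that are smooth everywhere. -/
lemma exists_smooth_approx {X : Opens (Pt d)} {Y : Set (Pt d)} (hY : IsOpen Y) {ψ : Pt d → ℂ}
    (hψ : ∀ x ∈ Y, ContDiffAt ℝ ∞ ψ x) :
    ∃ s : ℕ → Smooth X, ∀ K : Set (Pt d), IsCompact K → K ⊆ Y → K ⊆ X →
      ∃ l : ℕ, ∀ k ≥ l, ∀ x ∈ K, extZero (s k).1 x = ψ x := by
  obtain ⟨φ, hφY, hφ, hφr⟩ := hY.exists_contDiff_support_eq (n := ⊤)
  let f : ℕ → Pt d → ℂ := fun k x => Real.smoothTransition (k * φ x - 1) • ψ x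
  have hf : ∀ k x, ContDiffAt ℝ ∞ (f k) x := by
    intro k x
    by_cases hx : x ∈ Y
    · have h1 : ContDiff ℝ ∞ fun y => Real.smoothTransition (k * φ y - 1) :=
        Real.smoothTransition.contDiff.comp ((contDiff_const.mul hφ).sub contDiff_const)
      exact h1.contDiffAt.smul (hψ x hx)
    · have h0 : φ x = 0 := by
        rw [← Function.notMem_support, hφY]; exact hx
      have hc : ContinuousAt (fun y => (k : ℝ) * φ y) x :=
        (continuous_const.mul hφ.continuous).continuousAt
      have h1 : ∀ᶠ y in 𝓝 x, (k : ℝ) * φ y < 1 :=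
        hc.eventually_lt continuousAt_const (by rw [h0]; simp)
      refine (contDiffAt_const (c := (0 : ℂ))).congr_of_eventuallyEq ?_
      filter_upwards [h1] with y hy
      simp only [f]
      rw [Real.smoothTransition.zero_of_nonpos (by linarith), zero_smul]
  refine ⟨fun k => toSmooth (f k) fun x _ => (hf k x).contDiffWithinAt, fun K hK hKY hKX => ?_⟩
  have hpos : ∀ x ∈ K, 0 < φ x := fun x hx =>
    lt_of_le_of_ne (hφr (mem_range_self x)).1 (Ne.symm (by
      rw [← Function.mem_support, hφY]; exact hKY hx))
  obtain ⟨ε, hε, hεK⟩ : ∃ ε > 0, ∀ x ∈ K, ε ≤ φ x := by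
    rcases K.eq_empty_or_nonempty with rfl | hne
    · exact ⟨1, one_pos, fun x hx => absurd hx (notMem_empty x)⟩
    · obtain ⟨z, hz, hmin⟩ := hK.exists_isMinOn hne hφ.continuous.continuousOn
      exact ⟨φ z, hpos z hz, fun x hx => hmin hx⟩
  obtain ⟨l, hl⟩ := exists_nat_gt (2 / ε)
  refine ⟨l, fun k hk x hx => ?_⟩
  have h1 : 2 ≤ (k : ℝ) * φ x := by
    have h2 : 2 < (l : ℝ) * ε := (div_lt_iff₀ hε).1 hl
    have h3 : (l : ℝ) ≤ k := by exact_mod_cast hk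
    nlinarith [hεK x hx, (Nat.cast_nonneg l : (0 : ℝ) ≤ l)]
  rw [extZero_apply' _ (hKX hx)]
  change Real.smoothTransition (k * φ x - 1) • ψ x = ψ x
  rw [Real.smoothTransition.one_of_one_le (by linarith), one_smul]

lemma listD_zero (l : List (Pt d)) : listD l (fun _ => (0 : ℂ)) = fun _ => 0 := by
  induction l with
  | nil => rfl
  | cons v l ih =>
    change dirDeriv v (listD l _) = _
    rw [ih]
    funext x
    simp [dirDeriv]

lemma idealI_le_idealJ (X : Opens (Pt d)) : idealI X ≤ idealJ X := by
  rintro w ⟨A, S, hA, -, hw⟩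
  refine ⟨A, hA, fun x hx => ?_⟩
  obtain ⟨l, hl⟩ := hw x hx
  refine ⟨l, fun k hk p q => ?_⟩
  obtain ⟨Δ, hΔ, hxΔ, -, h0⟩ := hl k hk
  have he : extZero (w k).1 =ᶠ[𝓝 (x : Pt d)] fun _ => (0 : ℂ) := by
    filter_upwards [(X.isOpen.isOpenMap_subtype_val Δ hΔ).mem_nhds ⟨x, hxΔ, rfl⟩]
    rintro _ ⟨z, hz, rfl⟩
    rw [extZero_apply, h0 z hz]
  rw [partialD_congr he, partialD_eq_listD, listD_zero]

/-- A sequence vanishing near each point off a closed nowhere dense set, from some index on,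
belongs to the ideal; the constant representation `Γ_ν = Γ` serves. -/
lemma mem_idealI_of_locally_zero {X : Opens (Pt d)} {Sg : Set X} (hSg : IsClosed Sg)
    (hnd : IsNowhereDense Sg) {w : ℕ → Smooth X}
    (hw : ∀ x ∉ Sg, ∃ D : Set X, IsOpen D ∧ x ∈ D ∧ ∃ l : ℕ, ∀ k ≥ l, ∀ z ∈ D, (w k).1 z = 0) :
    w ∈ idealI X := by
  refine ⟨Sg, fun _ => Sg, hnd.isMeagre, ⟨fun _ => hSg, ?_⟩, fun x hx => ?_⟩
  · ext x
    simp only [mem_iInter, mem_iUnion, exists_prop]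
    exact ⟨fun h l => ⟨l, le_rfl, h⟩, fun h => (h 0).choose_spec.2⟩
  · obtain ⟨D, hD, hxD, l, hl⟩ := hw x hx
    exact ⟨l, fun k hk => ⟨D ∩ Sgᶜ, hD.inter hSg.isOpen_compl, ⟨hxD, hx⟩, inter_subset_right,
      fun z hz => hl k hk z hz.1⟩⟩

end

end FoamAlgebra

theorem theorem1 (d m : ℕ) (X : Opens (Pt d)) (_hX : (X : Set (Pt d)).Nonempty)
    (G : Pt d × (JetIndex d m → ℂ) → ℂ)
    (hG : AnalyticOnNhd ℝ G ((X : Set (Pt d)) ×ˢ univ))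
    (t₀ : ℝ) (g : Fin m → (Fin d → ℝ) → ℂ)
    (_hg : ∀ p, AnalyticOnNhd ℝ (g p) {y | (t₀, y) ∈ X}) :
    ∃ (Sg : Set X) (hSg : IsClosed Sg) (ψ : Smooth (offSet X Sg hSg))
      (s : ℕ → Smooth X),
      -- the singularity set: closed, nowhere dense, of measure zero, off the initial hypersurface
      IsNowhereDense Sg ∧ volume (Subtype.val '' Sg : Set (Pt d)) = 0 ∧
      (∀ x ∈ Sg, (x : Pt d).1 ≠ t₀) ∧
      -- `ψ` is analytic off `Sg`, and a classical solution of the initial value problem there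
      AnalyticOnNhd ℝ (extZero ψ.1) (offSet X Sg hSg) ∧
      (∀ x ∈ offSet X Sg hSg,
        partialD m 0 (extZero ψ.1) x = G (x, fun a =>
          partialD (a.1.1 : ℕ) (fun i => (a.1.2 i : ℕ)) (extZero ψ.1) x)) ∧
      (∀ (p : Fin m) (y : Fin d → ℝ), (t₀, y) ∈ X →
        partialD (p : ℕ) 0 (extZero ψ.1) (t₀, y) = g p y) ∧
      -- on each compact subset of `X \ Sg`, the terms of `s` finally coincide with `ψ`
      (∀ K : Set (Pt d), IsCompact K → K ⊆ offSet X Sg hSg →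
        ∃ l : ℕ, ∀ k ≥ l, ∀ x ∈ K, extZero (s k).1 x = extZero ψ.1 x) ∧
      -- `U = s + ℐ` is a global solution in `A_{Baire I}(X)`, equal to `ψ` on `X \ Sg`
      (opA hG (toA s) = 0 ∧ restrictA (offSet_le X Sg hSg) (toA s) = embA ψ) ∧
      -- `U = s + 𝒥` is a global solution in `B_{Baire I}(X)`, equal to `ψ` on `X \ Sg`
      (opB hG (toB s) = 0 ∧ restrictB (offSet_le X Sg hSg) (toB s) = embB ψ) := by
  obtain ⟨Y, hY, hnull, hSY, ψ, hψ, hψeq, hψg⟩ := exists_solution_off_null hG t₀ _hg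
  have hψs : ∀ x ∈ Y, ContDiffAt ℝ ∞ ψ x := fun x hx => (hψ x hx).contDiffAt
  obtain ⟨s, hs⟩ := exists_smooth_approx (X := X) hY hψs
  let Sg : Set X := {x | (x : Pt d) ∉ Y}
  have hSg : IsClosed Sg := (hY.preimage continuous_subtype_val).isClosed_compl
  have hmem : ∀ x, x ∈ offSet X Sg hSg ↔ x ∈ X ∧ x ∈ Y := by
    intro x
    constructor
    · rintro ⟨z, hz, rfl⟩
      exact ⟨z.2, not_not.1 hz⟩
    · rintro ⟨h1, h2⟩
      exact ⟨⟨x, h1⟩, not_not.2 h2, rfl⟩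
  have himg : (Subtype.val '' Sg : Set (Pt d)) = (X : Set (Pt d)) \ Y := by
    ext x
    constructor
    · rintro ⟨z, hz, rfl⟩
      exact ⟨z.2, hz⟩
    · rintro ⟨h1, h2⟩
      exact ⟨⟨x, h1⟩, h2, rfl⟩
  have hvol : volume (Subtype.val '' Sg : Set (Pt d)) = 0 := by rw [himg, hnull]
  -- a nonempty open set has positive measure
  have hnd : IsNowhereDense Sg := by
    rw [hSg.isNowhereDense_iff, ← not_nonempty_iff_eq_empty]
    rintro hne
    have hopen := X.isOpen.isOpenMap_subtype_val _ (isOpen_interior (s := Sg))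
    have hpos : 0 < (volume : Measure (Pt d)) (Subtype.val '' interior Sg) := by
      rw [Measure.volume_eq_prod]
      exact hopen.measure_pos _ (hne.image _)
    exact hpos.ne' (measure_mono_null (image_mono interior_subset) hvol)
  let ψ' : Smooth (offSet X Sg hSg) := toSmooth ψ fun x hx =>
    (hψs x ((hmem x).1 hx).2).contDiffWithinAt
  have hψ'e : ∀ x ∈ offSet X Sg hSg, extZero ψ'.1 =ᶠ[𝓝 x] ψ := fun x hx => by
    filter_upwards [(offSet X Sg hSg).isOpen.mem_nhds hx] with y hy
    exact extZero_apply' _ hy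
  -- near each point off the singularity set the terms of `s` finally coincide with `ψ`
  have hnear : ∀ x ∈ offSet X Sg hSg, ∃ D : Set (Pt d), IsOpen D ∧ x ∈ D ∧ ∃ l : ℕ, ∀ k ≥ l,
      ∀ z ∈ D, extZero (s k).1 z = ψ z := by
    intro x hx
    obtain ⟨K, hK, hxK, hKY⟩ := exists_compact_subset (offSet X Sg hSg).isOpen hx
    obtain ⟨l, hl⟩ := hs K hK (fun z hz => ((hmem z).1 (hKY hz)).2)
      fun z hz => ((hmem z).1 (hKY hz)).1
    exact ⟨interior K, isOpen_interior, hxK, l, fun k hk z hz => hl k hk z (interior_subset hz)⟩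
  have hopI : (fun k => op hG (s k)) ∈ idealI X := by
    refine mem_idealI_of_locally_zero hSg hnd fun x hx => ?_
    obtain ⟨D, hD, hxD, l, hl⟩ := hnear x ⟨x, hx, rfl⟩
    refine ⟨Subtype.val ⁻¹' (D ∩ Y), (hD.inter hY).preimage continuous_subtype_val,
      ⟨hxD, not_not.1 hx⟩, l, fun k hk z hz => ?_⟩
    have he : extZero (s k).1 =ᶠ[𝓝 (z : Pt d)] ψ := by
      filter_upwards [hD.mem_nhds hz.1] with y hy
      exact hl k hk y hy
    exact (opFun_congr he).trans (hψeq z hz.2)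
  have hresI : ((restrictSmooth (offSet_le X Sg hSg)).compLeft ℕ s - fun _ => ψ') ∈
      idealI (offSet X Sg hSg) := by
    refine mem_idealI_of_locally_zero isClosed_empty isNowhereDense_empty fun x _ => ?_
    obtain ⟨D, hD, hxD, l, hl⟩ := hnear x x.2
    refine ⟨Subtype.val ⁻¹' D, hD.preimage continuous_subtype_val, hxD, l, fun k hk z hz => ?_⟩
    have h1 := hl k hk z hz
    rw [extZero_apply' _ (offSet_le X Sg hSg z.2)] at h1
    exact sub_eq_zero.2 h1
  refine ⟨Sg, hSg, ψ', s, hnd, hvol, fun x hx hx1 => hx (hSY x x.2 hx1), fun x hx =>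
    (hψ x ((hmem x).1 hx).2).congr (hψ'e x hx).symm, fun x hx => ?_, fun p y hy => ?_,
    fun K hK hKY => ?_, ⟨?_, ?_⟩, ?_, ?_⟩
  · have h1 : opFun m G (extZero ψ'.1) x = 0 := by
      rw [opFun_congr (hψ'e x hx)]
      exact hψeq x ((hmem x).1 hx).2
    exact sub_eq_zero.1 h1
  · rw [partialD_congr (hψ'e _ ((hmem _).2 ⟨hy, hSY _ hy rfl⟩))]
    exact hψg p y hy
  · obtain ⟨l, hl⟩ := hs K hK (fun z hz => ((hmem z).1 (hKY hz)).2)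
      fun z hz => ((hmem z).1 (hKY hz)).1
    refine ⟨l, fun k hk x hx => ?_⟩
    rw [hl k hk x hx, (hψ'e x (hKY hx)).self_of_nhds]
  · exact Ideal.Quotient.eq_zero_iff_mem.2 hopI
  · exact Ideal.Quotient.eq.2 hresI
  · exact Ideal.Quotient.eq_zero_iff_mem.2 (idealI_le_idealJ _ hopI)
  · exact Ideal.Quotient.eq.2 (idealI_le_idealJ _ hresI)
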